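/- **Setting.** Let $G$ be a finite simple graph with vertex set $V$ (the qubits), and let $I,O\subseteq V$ be the inputs and outputs. Each $x\in O^c$ has a measurement angle $\alpha_x\in\mathbb R/2\pi\mathbb Z$. The angle is Pauli $X$ if $\alpha_x\in\{0,\pi\}$, Pauli $Y$ if $\alpha_x=\pm\pi/2$, and non-Pauli otherwise. A *flow* $(f,\preceq)$ is a map $f:O^c\to I^c$ and a partial order $\preceq$ on $V$ such that for all $x\in O^c$: $x\sim f(x)$; $x\preceq f(x)$; and $x\preceq y$ for all $y\sim f(x)$. We also allow a *loop flow edge* $f(x)=x$ in place of $x\sim f(x)$ (the other conditions being kept) when $x\in O^c$ is a non-input, is measured with a Pauli $Y$ angle, and is not the flow image of any other vertex. The *pattern with flow* $f$ performs first the controlled-$Z$ operators of all edges of $G$ and then, for each $i\in O^c$ in an order that follows $\preceq$, the measurement $M_i^{\alpha_i}$ (outcome $s_i$), the correction $X_{f(i)}^{s_i}$ (absent if $f(i)=i$) and the corrections $Z_k^{s_i}$ for all $k\sim f(i)$, $k\neq i$. Write ${}_t[M_i^\alpha]^s=M_i^\alpha X_i^sZ_i^t$. Patterns are executed from right to left,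 and signals $s,t,r$ are sums of outcomes modulo 2. The following procedures are applied in this order, each until none of its rules is applicable. * *Standardization*: $E_{ij}X_i^s\Rightarrow X_i^sZ_j^sE_{ij}$, $E_{ij}Z_i^s\Rightarrow Z_i^sE_{ij}$, ${}_t[M_i^\alpha]^sX_i^r\Rightarrow{}_t[M_i^\alpha]^{s+r}$, ${}_t[M_i^\alpha]^sZ_i^r\Rightarrow{}_{r+t}[M_i^\alpha]^s$. In addition, an entanglement command moves to the right past measurements and corrections on other qubits, and a correction moves to the left past measurements on other qubits and entanglement commands not involving its qubit. * *Pauli simplification*: the $X$-dependency of a Pauli $X$ measurement is dropped; that of a Pauli $Y$ measurement becomes a $Z$-dependency, ${}_t[M_i^\alpha]^s\Rightarrow{}_{s+t}[M_i^\alpha]^0$. * *Signal shifting*: ${}_t[M_i^\alpha]^s\Rightarrow S_i^t\,[M_i^\alpha]^s$ (for $t\ne0$), and $S_i^t$ moves to the left past measurements and corrections, replacing $s_i$ by $s_i+t$ in their signals. Corrections of the same type on one qubit are added, $X_j^sX_j^r=X_j^{s+r}$, and likewise for $Z$; remaining signal shifting commands at the left end are ignored. The *quantum computation depth* of the resulting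 pattern is the number of vertices on a longest directed path from a start node (in-degree 0) to an end node (out-degree 0) in the digraph on $V$ that has an arc $i\to j$ whenever $s_i$ occurs in a signal of the measurement of $j$ or of a correction on $j$. **Proposition.** Let $\mathcal P$ be a pattern with flow $f$ (possibly with loop flow edges), in which at least one measured qubit has a neighbour in $G$; if $f$ has no loops this just says that $O^c\neq\emptyset$. Then standardization, Pauli simplification and signal shifting of $\mathcal P$ can be carried out, and for every resulting pattern: its quantum computation depth is equal to $2$ if and only if no qubit measured with a non-Pauli angle is the flow image $f(i)$ of another vertex $i\in O^c$. Moreover, let $j$ be a qubit measured with a non-Pauli angle that is not the flow image of another vertex. * Suppose that $f$ arises from a flow $f_0$ without loops by replacing some of its values by loops $f(x)=x$, and that every measured non-input qubit that is not an image under $f_0$ carries such a loop (every flow line begins at an input or at a loop). Then $j$ is either an input or adjacent to a vertex with a loop flow edge. * If $|I|=|O|$, then $j$ is an input. -/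

import Mathlib

open scoped symmDiff

namespace MBQC

/-- A signal `∑ i ∈ D, s_i` (mod 2), given by its domain `D`. The sum of two signals is the
symmetric difference of their domains, and the zero signal is `∅`. -/
abbrev Signal (V : Type*) := Finset V

/-- Substitution of `s_i + t` for `s_i` in the signal `s`. -/
def Signal.shift {V : Type*} [DecidableEq V] (s : Signal V) (i : V) (t : Signal V) : Signal V :=
  if i ∈ s then s ∆ t else s

/-- Commands on a set `V` of qubits. Measurement angles live in `ℝ / 2πℤ`.
Preparations are left implicit: exactly the non-input qubits are prepared, in the state `|+⟩`.
* `ent s(i, j)` is the controlled-`Z` operator on `i` and `j`;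
* `meas i α s t` is the measurement of `i` with angle `(-1)^s α + t π`, that is `M_i^α X_i^s Z_i^t`;
* `corrX i s`, `corrZ i s` are the corrections `X_i^s`, `Z_i^s`;
* `sig i t` is the signal shifting command, which adds `t` to `s_i`. -/
inductive Command (V : Type*) where
  | ent (e : Sym2 V)
  | meas (i : V) (α : Real.Angle) (s t : Signal V)
  | corrX (i : V) (s : Signal V)
  | corrZ (i : V) (s : Signal V)
  | sig (i : V) (t : Signal V)

/-- A command sequence, written as usual: the last entry of the list is executed first. -/
abbrev Pattern (V : Type*) := List (Command V)

open Command

section Rewriting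

variable {V : Type*}

/-- One application of a rule `R` at some place of a pattern. -/
inductive Step (R : Pattern V → Pattern V → Prop) : Pattern V → Pattern V → Prop
  | intro (A B l r : Pattern V) (h : R l r) : Step R (A ++ l ++ B) (A ++ r ++ B)

/-- `Q` is obtained from `P` by applying the rules `R` until no rule is applicable any more. -/
def IsNormalFormOf (R : Pattern V → Pattern V → Prop) (P Q : Pattern V) : Prop :=
  Relation.ReflTransGen (Step R) P Q ∧ ∀ Q', ¬ Step R Q Q'

/-- The rewrite rules of standardization, with the free commutation rules. -/
inductive StdRule [DecidableEq V] : Pattern V → Pattern V → Prop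
  | entX (i j : V) (s : Signal V) :
      StdRule [ent s(i, j), corrX i s] [corrX i s, corrZ j s, ent s(i, j)]
  | entZ (i j : V) (s : Signal V) :
      StdRule [ent s(i, j), corrZ i s] [corrZ i s, ent s(i, j)]
  | measX (i : V) (α : Real.Angle) (s t r : Signal V) :
      StdRule [meas i α s t, corrX i r] [meas i α (s ∆ r) t]
  | measZ (i : V) (α : Real.Angle) (s t r : Signal V) :
      StdRule [meas i α s t, corrZ i r] [meas i α s (r ∆ t)]
  | freeEntMeas (e : Sym2 V) (k : V) (α : Real.Angle) (s t : Signal V) (h : k ∉ e) :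
      StdRule [ent e, meas k α s t] [meas k α s t, ent e]
  | freeEntX (e : Sym2 V) (k : V) (s : Signal V) (h : k ∉ e) :
      StdRule [ent e, corrX k s] [corrX k s, ent e]
  | freeEntZ (e : Sym2 V) (k : V) (s : Signal V) (h : k ∉ e) :
      StdRule [ent e, corrZ k s] [corrZ k s, ent e]
  | freeMeasX (k i : V) (α : Real.Angle) (s t r : Signal V) (h : k ≠ i) :
      StdRule [meas k α s t, corrX i r] [corrX i r, meas k α s t]
  | freeMeasZ (k i : V) (α : Real.Angle) (s t r : Signal V) (h : k ≠ i) :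
      StdRule [meas k α s t, corrZ i r] [corrZ i r, meas k α s t]

/-- The angles for which `M^α` is a Pauli `X` measurement (so that `M^α X = M^α`). -/
def IsXAngle (a : Real.Angle) : Prop := a = 0 ∨ a = (Real.pi : Real.Angle)

/-- The angles for which `M^α` is a Pauli `Y` measurement (so that `M^α X = M^α Z`). -/
def IsYAngle (a : Real.Angle) : Prop :=
  a = ((Real.pi / 2 : ℝ) : Real.Angle) ∨ a = ((-(Real.pi / 2) : ℝ) : Real.Angle)

/-- The angles of Pauli measurements. -/
def IsPauliAngle (a : Real.Angle) : Prop := IsXAngle a ∨ IsYAngle a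

/-- Pauli simplification: an `X`-dependency of a Pauli `X` measurement is dropped, and an
`X`-dependency of a Pauli `Y` measurement is turned into a `Z`-dependency. -/
inductive PauliRule [DecidableEq V] : Pattern V → Pattern V → Prop
  | dropX (i : V) (α : Real.Angle) (s t : Signal V) (hα : IsXAngle α) (hs : s ≠ ∅) :
      PauliRule [meas i α s t] [meas i α ∅ t]
  | turnY (i : V) (α : Real.Angle) (s t : Signal V) (hα : IsYAngle α) (hs : s ≠ ∅) :
      PauliRule [meas i α s t] [meas i α ∅ (s ∆ t)]

/-- The signal shifting rules. -/
inductive ShiftRule [DecidableEq V] : Pattern V → Pattern V → Prop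
  | extract (i : V) (α : Real.Angle) (s t : Signal V) (ht : t ≠ ∅) :
      ShiftRule [meas i α s t] [sig i t, meas i α s ∅]
  | passX (i j : V) (s t : Signal V) :
      ShiftRule [corrX j s, sig i t] [sig i t, corrX j (s.shift i t)]
  | passZ (i j : V) (s t : Signal V) :
      ShiftRule [corrZ j s, sig i t] [sig i t, corrZ j (s.shift i t)]
  | passMeas (i j : V) (α : Real.Angle) (s t r : Signal V) :
      ShiftRule [meas j α s t, sig i r] [sig i r, meas j α (s.shift i r) (t.shift i r)]

/-- `Q` results from `P` by standardization, then Pauli simplification, then signal shifting. -/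
def IsSimplificationOf [DecidableEq V] (P Q : Pattern V) : Prop :=
  ∃ P₁ P₂, IsNormalFormOf StdRule P P₁ ∧ IsNormalFormOf PauliRule P₁ P₂ ∧
    IsNormalFormOf ShiftRule P₂ Q

end Rewriting

section Depth

variable {V : Type*} [DecidableEq V]

/-- The signal of the `X` correction on the qubit `j` in a pattern (with
`X_j^s X_j^r = X_j^(s+r)`). -/
def corrXSignal (j : V) : Pattern V → Signal V
  | [] => ∅
  | corrX i s :: P => if i = j then s ∆ corrXSignal j P else corrXSignal j P
  | _ :: P => corrXSignal j P

/-- The signal of the `Z` correction on the qubit `j` in a pattern (with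
`Z_j^s Z_j^r = Z_j^(s+r)`). -/
def corrZSignal (j : V) : Pattern V → Signal V
  | [] => ∅
  | corrZ i s :: P => if i = j then s ∆ corrZSignal j P else corrZSignal j P
  | _ :: P => corrZSignal j P

/-- The arcs `i → j` of the execution digraph of a pattern in standard form. (The remaining signal
shifting commands at the end of the pattern only relabel outcomes and are ignored.) -/
def ExecArc (P : Pattern V) (i j : V) : Prop :=
  (∃ α s t, meas j α s t ∈ P ∧ (i ∈ s ∨ i ∈ t)) ∨ i ∈ corrXSignal j P ∨ i ∈ corrZSignal j P

/-- `l` lists the vertices of a directed path of the digraph `R` from a start node (of in-degree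
zero) to an end node (of out-degree zero). -/
def IsStartEndPath (R : V → V → Prop) (l : List V) : Prop :=
  l ≠ [] ∧ l.Nodup ∧ l.IsChain R ∧ (∀ x ∈ l.head?, ∀ y, ¬ R y x) ∧ (∀ x ∈ l.getLast?, ∀ y, ¬ R x y)

/-- Quantum computation depth: the number of vertices on a longest directed path from a start node
to an end node in the execution digraph. -/
noncomputable def quantumDepth (P : Pattern V) : ℕ :=
  sSup {n | ∃ l : List V, IsStartEndPath (ExecArc P) l ∧ l.length = n}

end Depth

section Flow

variable {V : Type*}

/-- `(f, ≼)` is a flow of the geometry `(G, I, O)`; only the values of `f` outside `O` matter. -/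
structure IsFlow (G : SimpleGraph V) (I O : Finset V) (f : V → V) (ord : PartialOrder V) :
    Prop where
  maps : ∀ x ∉ O, f x ∉ I
  adj : ∀ x ∉ O, G.Adj x (f x)
  le_image : ∀ x ∉ O, ord.le x (f x)
  le_nbr : ∀ x ∉ O, ∀ y, G.Adj (f x) y → ord.le x y

/-- A flow in which a non-input qubit that is measured with a Pauli `Y` angle and is not the image
of any other vertex may carry a loop flow edge `f x = x`. -/
structure IsLoopFlow (G : SimpleGraph V) (I O : Finset V) (α : V → Real.Angle) (f : V → V)
    (ord : PartialOrder V) : Prop where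
  maps : ∀ x ∉ O, f x ∉ I
  adj_or_loop : ∀ x ∉ O,
    G.Adj x (f x) ∨ (f x = x ∧ IsYAngle (α x) ∧ ∀ j ∉ O, f j = x → j = x)
  le_image : ∀ x ∉ O, ord.le x (f x)
  le_nbr : ∀ x ∉ O, ∀ y, G.Adj (f x) y → ord.le x y

variable [Fintype V] [DecidableEq V]

/-- The measurement of `i`, followed by its corrections: `X` on `f i` and `Z` on the neighbours of
`f i` other than `i`, all controlled by the outcome `s_i`. (If `f i = i` there is no `X`
correction, since `i` has been measured.) -/
noncomputable def flowBlock (G : SimpleGraph V) [DecidableRel G.Adj] (α : V → Real.Angle)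
    (f : V → V) (i : V) : Pattern V :=
  (if f i = i then [] else [corrX (f i) {i}]) ++
    ((G.neighborFinset (f i)).erase i).toList.map (fun k => corrZ k {i}) ++ [meas i (α i) ∅ ∅]

/-- `P` is the pattern that the flow `(f, ≼)` defines on the geometry with graph `G` and outputs
`O`, for measurement angles `α`: first the entanglement commands of all the edges of `G`, then, for
each measured qubit, in an order `l` that follows `≼`, the measurement and its corrections. -/
def IsFlowPattern (G : SimpleGraph V) [DecidableRel G.Adj] (O : Finset V) (α : V → Real.Angle)
    (f : V → V) (ord : PartialOrder V) (P : Pattern V) : Prop :=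
  ∃ l : List V, l.Nodup ∧ (∀ x, x ∈ l ↔ x ∉ O) ∧ l.Pairwise (fun x y => ¬ ord.lt y x) ∧
    P = l.reverse.flatMap (flowBlock G α f) ++ G.edgeFinset.toList.map ent

/-- `j` is the flow image of a vertex other than `j`. -/
def IsImageOfOther (O : Finset V) (f : V → V) (j : V) : Prop := ∃ i ∉ O, i ≠ j ∧ f i = j

end Flow

end MBQC

/-! Confluence is not needed: each procedure terminates because a weight decreases, and each has an
invariant that determines the dependencies in every normal form.

Standardization gives the measurement of `j` the X-signal `xDeps` (all `i ≠ j` with `f i = j`) and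
the Z-signal `zDeps` (all `i ≠ j` with `f i ∼ j`); on outputs the corrections carry these signals
(`listPattern_standardized`). Pauli simplification turns the signals of measurements into `pauliX`
and `pauliZ`. Signal shifting is a linear change of variables over the field with two elements. For
fixed `k`, let `φ i` be the coefficient of the shifted outcome of `k` in the original outcome of
`i`; then `φ j` is `δ_jk` plus the sum of `φ` over the Z-dependency of `j`. There is an arc `k → j`
iff `φ` sums to 1 over the X-signal of a non-Pauli measurement `j`, or over a correction signal of
an output `j` (`execArc_spec`).

The flow conditions make `f` injective off `O` and dependencies strictly increasing, so `φ k = 1`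
for measured `k`, and `φ` is supported above `k`. If a non-Pauli measured `j` is the image of `i ≠
j`, its X-signal is `{i}`, which gives an arc `i → j`. The key lemma `IsInfluence.exists_output`
gives an arc from `j` to an output `v`, and `i → j → v` forces depth at least 3. If there is no such
`j`, all arcs run from measured qubits to outputs, and the depth is 2 as soon as one arc exists; a
measured qubit with a neighbour provides one.

The statements on inputs follow from the fact that non-Pauli qubits carry no loops, and, when `|I| =
|O|`, from counting with the injectivity of `f`. -/

namespace MBQC

open Command

/-! ### Termination of the three rewriting systems -/

section Termination

variable {V : Type*}

/-- A rewriting system that decreases a measure has normal forms. -/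
theorem exists_isNormalFormOf (R : Pattern V → Pattern V → Prop) (μ : Pattern V → ℕ)
    (hμ : ∀ P Q, Step R P Q → μ Q < μ P) (P : Pattern V) : ∃ Q, IsNormalFormOf R P Q := by
  induction h : μ P using Nat.strong_induction_on generalizing P with
  | _ n ih =>
    by_cases hP : ∃ Q, Step R P Q
    · obtain ⟨Q, hQ⟩ := hP
      obtain ⟨Q', h1, h2⟩ := ih (μ Q) (h ▸ hμ P Q hQ) Q rfl
      exact ⟨Q', .head hQ h1, h2⟩
    · exact ⟨P, .refl, fun Q' hQ' => hP ⟨Q', hQ'⟩⟩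

/-- The composition of the functions `F c`, for `c` in `P`, at `0`. -/
def interp (F : Command V → ℕ → ℕ) : Pattern V → ℕ
  | [] => 0
  | c :: P => F c (interp F P)

theorem interp_append_lt (F : Command V → ℕ → ℕ) (hF : ∀ c, StrictMono (F c)) (A P Q : Pattern V)
    (h : interp F Q < interp F P) : interp F (A ++ Q) < interp F (A ++ P) := by
  induction A with
  | nil => exact h
  | cons c A ih => exact hF c ih

theorem exists_isNormalFormOf_of_interp (R : Pattern V → Pattern V → Prop)
    (F : Command V → ℕ → ℕ) (hF : ∀ c, StrictMono (F c))
    (h : ∀ l r, R l r → ∀ B, interp F (r ++ B) < interp F (l ++ B)) (P : Pattern V) :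
    ∃ Q, IsNormalFormOf R P Q := by
  refine exists_isNormalFormOf R (interp F) ?_ P
  rintro _ _ ⟨A, B, l, r, hlr⟩
  simpa using interp_append_lt F hF A _ _ (h l r hlr B)

variable [DecidableEq V]

/-- The interpretation that shows that standardization terminates. -/
def stdWeight : Command V → ℕ → ℕ
  | ent _, x => 3 * x
  | meas _ _ _ _, x => 2 * x + 1
  | _, x => x + 1

theorem exists_std_normalForm (P : Pattern V) : ∃ Q, IsNormalFormOf StdRule P Q := by
  refine exists_isNormalFormOf_of_interp _ stdWeight ?_ ?_ P
  · rintro (_ | _ | _ | _ | _) x y h <;> simp only [stdWeight] <;> omega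
  · rintro _ _ (_ | _ | _ | _ | _ | _ | _ | _ | _) B <;>
      simp only [interp, stdWeight, List.cons_append, List.nil_append] <;> omega

/-- The interpretation that shows that Pauli simplification terminates. -/
def pauliWeight : Command V → ℕ → ℕ
  | meas _ _ s _, x => if s = ∅ then x else x + 1
  | _, x => x

theorem exists_pauli_normalForm (P : Pattern V) : ∃ Q, IsNormalFormOf PauliRule P Q := by
  refine exists_isNormalFormOf_of_interp _ pauliWeight ?_ ?_ P
  · rintro (_ | _ | _ | _ | _) x y h <;> simp only [pauliWeight] <;> try split_ifs <;> omega
    all_goals omega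
  · rintro _ _ (⟨_, _, _, _, _, hs⟩ | ⟨_, _, _, _, _, hs⟩) B <;>
      simp [interp, pauliWeight, hs]

/-- The interpretation that shows that signal shifting terminates. -/
def shiftWeight : Command V → ℕ → ℕ
  | meas _ _ _ t, x => if t = ∅ then 4 * x else 4 * x + 2
  | ent _, x => x
  | sig _ _, x => x + 1
  | _, x => 2 * x

/-- Extraction trades the surplus 2 of a nonempty Z-signal for the 1 of a shifting command. Passing
a measurement lowers `4 * (x + 1)` to at most `4 * x + 2 + 1`, whatever happens to the Z-signal. -/
theorem exists_shift_normalForm (P : Pattern V) : ∃ Q, IsNormalFormOf ShiftRule P Q := by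
  refine exists_isNormalFormOf_of_interp _ shiftWeight ?_ ?_ P
  · rintro (_ | _ | _ | _ | _) x y h <;> simp only [shiftWeight] <;> (try split_ifs) <;> omega
  · rintro _ _ (⟨_, _, _, _, ht⟩ | _ | _ | _) B <;>
      simp only [interp, shiftWeight, List.cons_append, List.nil_append] <;>
      (try split_ifs) <;> (try contradiction) <;> omega

theorem exists_isSimplificationOf (P : Pattern V) : ∃ Q, IsSimplificationOf P Q := by
  obtain ⟨P₁, h₁⟩ := exists_std_normalForm P
  obtain ⟨P₂, h₂⟩ := exists_pauli_normalForm P₁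
  obtain ⟨Q, h₃⟩ := exists_shift_normalForm P₂
  exact ⟨Q, P₁, P₂, h₁, h₂, h₃⟩

end Termination

/-! ### Normal forms, order of entanglement, and causality -/

section Invariants

variable {V : Type*}

/-- Entanglement commands. -/
def IsEnt : Command V → Prop
  | ent _ => True
  | _ => False

/-- Signal shifting commands. -/
def IsSig : Command V → Prop
  | sig _ _ => True
  | _ => False

/-- Corrections. -/
def IsCorr : Command V → Prop
  | corrX _ _ => True
  | corrZ _ _ => True
  | _ => False

/-- All entanglement commands are executed before all other commands. -/
def EntLast (P : Pattern V) : Prop := P.Pairwise fun c d => IsEnt c → IsEnt d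

/-- Since `l` is nonempty and free of entanglement, no entanglement command can occur in `A`, so
nothing in `A` constrains `r`. -/
theorem EntLast.replace {A B l r : Pattern V} (h : EntLast (A ++ l ++ B)) (hl : l ≠ [])
    (hl' : ∀ c ∈ l, ¬ IsEnt c) (hr : ∀ c ∈ r, ¬ IsEnt c) : EntLast (A ++ r ++ B) := by
  obtain ⟨d, hd⟩ := List.exists_mem_of_ne_nil l hl
  simp only [EntLast, List.append_assoc, List.pairwise_append, List.mem_append] at h ⊢
  obtain ⟨hA, ⟨-, hB, -⟩, hAB⟩ := h
  refine ⟨hA, ⟨?_, hB, fun c hc _ _ h => (hr c hc h).elim⟩, ?_⟩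
  · exact List.Pairwise.imp_of_mem (fun hc _ _ h => (hr _ hc h).elim)
      (List.pairwise_of_forall (R := fun _ _ => True) fun _ _ => trivial)
  · rintro a ha b (hb | hb) h
    · exact (hl' d hd (hAB a ha d (.inl hd) h)).elim
    · exact hAB a ha b (.inr hb) h

/-- `P` is a normal form for the rules `R`. -/
def Normal (R : Pattern V → Pattern V → Prop) (P : Pattern V) : Prop := ∀ Q, ¬ Step R P Q

theorem Normal.not_rule {R : Pattern V → Pattern V → Prop} {A l B : Pattern V}
    (h : Normal R (A ++ l ++ B)) (r : Pattern V) : ¬ R l r :=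
  fun hr => h _ (.intro A B l r hr)

theorem Normal.of_cons {R : Pattern V → Pattern V → Prop} {c : Command V} {P : Pattern V}
    (h : Normal R (c :: P)) : Normal R P := by
  rintro _ ⟨A, B, l, r, hr⟩
  exact h _ (.intro (c :: A) B l r hr)

theorem EntLast.of_cons {c : Command V} {P : Pattern V} (h : EntLast (c :: P)) : EntLast P :=
  (List.pairwise_cons.1 h).2

/-- An invariant of single steps holds for normal forms. -/
theorem IsNormalFormOf.invariant {R : Pattern V → Pattern V → Prop} {I : Pattern V → Prop}
    (hI : ∀ A B l r, R l r → I (A ++ l ++ B) → I (A ++ r ++ B)) {P Q : Pattern V}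
    (h : IsNormalFormOf R P Q) (hP : I P) : I Q := by
  obtain ⟨h, -⟩ := h
  induction h with
  | refl => exact hP
  | tail _ h ih =>
    obtain ⟨A, B, l, r, hr⟩ := h
    exact hI A B l r hr ih

variable [DecidableEq V]

/-- The qubits measured in a pattern. -/
def measured : Pattern V → Finset V
  | [] => ∅
  | meas i _ _ _ :: P => insert i (measured P)
  | _ :: P => measured P

theorem mem_measured {P : Pattern V} {i : V} :
    i ∈ measured P ↔ ∃ β s t, meas i β s t ∈ P := by
  induction P with
  | nil => simp [measured]
  | cons c P ih =>
    cases c <;> simp [measured, ih]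
    rename_i k β s t
    constructor
    · rintro (rfl | ⟨β, s, t, h⟩)
      · exact ⟨_, _, _, .inl ⟨rfl, rfl, rfl, rfl⟩⟩
      · exact ⟨_, _, _, .inr h⟩
    · rintro ⟨β, s, t, h | h⟩
      · exact .inl h.1
      · exact .inr ⟨β, s, t, h⟩

theorem measured_append (A B : Pattern V) : measured (A ++ B) = measured A ∪ measured B := by
  induction A with
  | nil => simp [measured]
  | cons c A ih => cases c <;> simp [measured, ih]

/-- Every qubit is measured at most once, and signals only involve earlier outcomes. -/
def Causal : Pattern V → Prop
  | [] => True
  | ent _ :: P => Causal P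
  | meas i _ s t :: P => i ∉ measured P ∧ s ⊆ measured P ∧ t ⊆ measured P ∧ Causal P
  | corrX _ s :: P => s ⊆ measured P ∧ Causal P
  | corrZ _ s :: P => s ⊆ measured P ∧ Causal P
  | sig i t :: P => i ∈ measured P ∧ t ⊆ measured P ∧ Causal P

/-- Causality of the later commands `A` depends on the earlier ones only through the set of measured
qubits. -/
theorem Causal.append_congr {A P Q : Pattern V} (h : Causal (A ++ P))
    (hm : measured P = measured Q) (hc : Causal P → Causal Q) : Causal (A ++ Q) := by
  induction A with
  | nil => exact hc h
  | cons c A ih =>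
    have := measured_append A P
    have := measured_append A Q
    cases c <;> simp_all [Causal]

theorem Causal.of_cons {c : Command V} {P : Pattern V} (h : Causal (c :: P)) : Causal P := by
  cases c <;> simp_all [Causal]

theorem Causal.of_append {A P : Pattern V} (h : Causal (A ++ P)) : Causal P := by
  induction A with
  | nil => exact h
  | cons c A ih => exact ih h.of_cons

theorem symmDiff_subset_of_subset {s t u : Finset V} (hs : s ⊆ u) (ht : t ⊆ u) : s ∆ t ⊆ u := by
  intro x hx
  rcases Finset.mem_symmDiff.1 hx with h | h
  · exact hs h.1
  · exact ht h.1

theorem shift_subset_of_subset {s t u : Finset V} (i : V) (hs : s ⊆ u) (ht : t ⊆ u) :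
    Signal.shift s i t ⊆ u := by
  unfold Signal.shift
  split_ifs
  · exact symmDiff_subset_of_subset hs ht
  · exact hs

end Invariants

/-! ### Invariants of standardization -/

section Standardization

variable {V : Type*} [DecidableEq V]

/-- The signal of the `X` corrections on `j` since the last measurement of `j`. -/
def pendX (j : V) : Pattern V → Signal V
  | [] => ∅
  | corrX i s :: P => if i = j then s ∆ pendX j P else pendX j P
  | meas i _ _ _ :: P => if i = j then ∅ else pendX j P
  | _ :: P => pendX j P

/-- The signal of the `Z` corrections on `j` since the last measurement of `j`. -/
def pendZ (j : V) : Pattern V → Signal V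
  | [] => ∅
  | corrZ i s :: P => if i = j then s ∆ pendZ j P else pendZ j P
  | meas i _ _ _ :: P => if i = j then ∅ else pendZ j P
  | _ :: P => pendZ j P

/-- The `X`-dependency of the measurement of `j`, with the corrections before it absorbed. -/
def recX (j : V) : Pattern V → Signal V
  | [] => ∅
  | meas i _ s _ :: P => if i = j then s ∆ pendX j P else recX j P
  | _ :: P => recX j P

/-- The `Z`-dependency of the measurement of `j`, with the corrections before it absorbed. -/
def recZ (j : V) : Pattern V → Signal V
  | [] => ∅
  | meas i _ _ t :: P => if i = j then t ∆ pendZ j P else recZ j P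
  | _ :: P => recZ j P

/-- Two patterns (with entanglement first) that agree up to commuting and absorbing corrections. -/
structure StdEq (P Q : Pattern V) : Prop where
  measured : measured P = measured Q
  pendX : ∀ j, pendX j P = pendX j Q
  pendZ : ∀ j, pendZ j P = pendZ j Q
  recX : ∀ j, recX j P = recX j Q
  recZ : ∀ j, recZ j P = recZ j Q

theorem StdEq.append {P Q : Pattern V} (h : StdEq P Q) (A : Pattern V) :
    StdEq (A ++ P) (A ++ Q) := by
  induction A with
  | nil => exact h
  | cons c A ih =>
    obtain ⟨h1, h2, h3, h4, h5⟩ := ih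
    cases c <;> constructor <;>
      simp_all [MBQC.measured, MBQC.pendX, MBQC.pendZ, MBQC.recX, MBQC.recZ]

theorem StdRule.stdEq {l r : Pattern V} (h : StdRule l r) (hl : ∀ c ∈ l, ¬ IsEnt c)
    (B : Pattern V) : StdEq (l ++ B) (r ++ B) := by
  cases h
  case measX =>
    constructor <;> intros <;> simp only [measured, pendX, pendZ, recX, recZ, List.cons_append,
      List.nil_append]
    all_goals split_ifs <;> simp [symmDiff_assoc]
  case measZ =>
    constructor <;> intros <;> simp only [measured, pendX, pendZ, recX, recZ, List.cons_append,
      List.nil_append]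
    all_goals split_ifs <;> simp [symmDiff_assoc, symmDiff_left_comm]
  case freeMeasX h =>
    constructor <;> intros <;> simp [measured, pendX, pendZ, recX, recZ] <;> grind
  case freeMeasZ h =>
    constructor <;> intros <;> simp [measured, pendX, pendZ, recX, recZ] <;> grind
  all_goals simp [IsEnt] at hl

theorem StdRule.causal {l r : Pattern V} (h : StdRule l r) (hl : ∀ c ∈ l, ¬ IsEnt c)
    (B : Pattern V) (hB : Causal (l ++ B)) : Causal (r ++ B) := by
  cases h
  case measX | measZ =>
    simp_all [Causal, measured, symmDiff_subset_of_subset]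
  case freeMeasX | freeMeasZ =>
    simp_all [Causal, measured]
    exact hB.2.2.2.1.trans (Finset.subset_insert _ _)
  all_goals simp [IsEnt] at hl

/-- The properties of a pattern that are preserved by the three procedures. -/
structure WellFormed (α : V → Real.Angle) (P : Pattern V) : Prop where
  causal : Causal P
  entLast : EntLast P
  angle : ∀ i β s t, meas i β s t ∈ P → β = α i

/-- What standardization preserves, starting from `P`. -/
structure StdInv (α : V → Real.Angle) (P Q : Pattern V) : Prop extends WellFormed α Q where
  stdEq : StdEq P Q
  notSig : ∀ c ∈ Q, ¬ IsSig c

theorem StdEq.trans {P Q R : Pattern V} (h : StdEq P Q) (h' : StdEq Q R) : StdEq P R :=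
  ⟨h.1.trans h'.1, fun j => (h.2 j).trans (h'.2 j), fun j => (h.3 j).trans (h'.3 j),
    fun j => (h.4 j).trans (h'.4 j), fun j => (h.5 j).trans (h'.5 j)⟩

theorem WellFormed.append_congr {α : V → Real.Angle} {A B l r : Pattern V}
    (h : WellFormed α (A ++ l ++ B)) (hl : l ≠ []) (hl' : ∀ c ∈ l, ¬ IsEnt c)
    (hr : ∀ c ∈ r, ¬ IsEnt c) (hm : measured (l ++ B) = measured (r ++ B))
    (hc : Causal (l ++ B) → Causal (r ++ B))
    (ha : ∀ i β s t, meas i β s t ∈ r → ∃ s' t', meas i β s' t' ∈ l) :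
    WellFormed α (A ++ r ++ B) := by
  refine ⟨?_, h.entLast.replace hl hl' hr, fun i β s t hi => ?_⟩
  · have := h.causal
    rw [List.append_assoc] at this ⊢
    exact this.append_congr hm hc
  · simp only [List.mem_append] at hi
    rcases hi with (hi | hi) | hi
    · exact h.angle i β s t (by simp [hi])
    · obtain ⟨s', t', h'⟩ := ha i β s t hi
      exact h.angle i β s' t' (by simp [h'])
    · exact h.angle i β s t (by simp [hi])

theorem StdRule.ne_nil {l r : Pattern V} (h : StdRule l r) : l ≠ [] := by
  cases h <;> simp

/-- A rule with an entanglement command has it to the left of another kind of command, which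
`EntLast` forbids. Only the rules for measurements and corrections ever apply. -/
theorem StdRule.not_isEnt {l r : Pattern V} (h : StdRule l r) {A B : Pattern V}
    (hl : EntLast (A ++ l ++ B)) : ∀ c ∈ l, ¬ IsEnt c := by
  have : EntLast l := (List.pairwise_append.1 (List.pairwise_append.1 hl).1).2.1
  cases h <;> simp_all [EntLast, IsEnt]

theorem StdRule.not_isEnt_right {l r : Pattern V} (h : StdRule l r) (hl : ∀ c ∈ l, ¬ IsEnt c) :
    ∀ c ∈ r, ¬ IsEnt c := by
  cases h <;> simp_all [IsEnt]

theorem StdInv.step {α : V → Real.Angle} {P A B l r : Pattern V} (hr : StdRule l r)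
    (h : StdInv α P (A ++ l ++ B)) : StdInv α P (A ++ r ++ B) := by
  have hl := hr.not_isEnt h.entLast
  have he := hr.stdEq hl B
  refine ⟨h.append_congr hr.ne_nil hl (hr.not_isEnt_right hl) he.measured (hr.causal hl B) ?_,
    ?_, ?_⟩
  · intro i β s t hi
    cases hr <;> simp_all [IsEnt]
  · have := h.stdEq
    rw [List.append_assoc] at this ⊢
    exact this.trans (he.append A)
  · intro c hc
    simp only [List.mem_append] at hc
    rcases hc with (hc | hc) | hc
    · exact h.notSig c (by simp [hc])
    · cases hr <;> simp at hc <;> rcases hc with rfl | rfl | rfl <;> simp [IsSig]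
    · exact h.notSig c (by simp [hc])

/-- A correction directly before a measurement in time would be absorbed by it or commute past it.
Hence in a normal form all corrections come after all measurements. -/
theorem Normal.not_isCorr_of_meas {i : V} {β : Real.Angle} {s t : Signal V} {P : Pattern V}
    (h : Normal StdRule (meas i β s t :: P)) (he : EntLast P) (hs : ∀ c ∈ P, ¬ IsSig c) :
    ∀ c ∈ P, ¬ IsCorr c := by
  induction P generalizing i β s t with
  | nil => simp
  | cons c P ih =>
    have key : ∀ r, ¬ StdRule [meas i β s t, c] r := fun r =>
      Normal.not_rule (A := []) (l := [_, _]) (B := P) h r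
    cases c with
    | ent e =>
      intro d hd
      rcases List.mem_cons.1 hd with rfl | hd
      · simp [IsCorr]
      · have := (List.pairwise_cons.1 he).1 d hd trivial
        cases d <;> simp_all [IsEnt, IsCorr]
    | meas k γ s' t' =>
      intro d hd
      rcases List.mem_cons.1 hd with rfl | hd
      · simp [IsCorr]
      · exact ih h.of_cons he.of_cons (fun c hc => hs c (by simp [hc])) d hd
    | corrX k r =>
      by_cases hk : i = k
      · subst hk; exact (key _ (.measX ..)).elim
      · exact (key _ (.freeMeasX _ _ _ _ _ _ hk)).elim
    | corrZ k r =>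
      by_cases hk : i = k
      · subst hk; exact (key _ (.measZ ..)).elim
      · exact (key _ (.freeMeasZ _ _ _ _ _ _ hk)).elim
    | sig k r => exact (hs (sig k r) (by simp) trivial).elim

theorem pend_eq_empty {P : Pattern V} (h : ∀ c ∈ P, ¬ IsCorr c) (j : V) :
    pendX j P = ∅ ∧ pendZ j P = ∅ ∧ corrXSignal j P = ∅ ∧ corrZSignal j P = ∅ := by
  induction P with
  | nil => simp [pendX, pendZ, corrXSignal, corrZSignal]
  | cons c P ih =>
    have := ih fun c hc => h c (by simp [hc])
    cases c <;> simp_all [pendX, pendZ, corrXSignal, corrZSignal, IsCorr]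

theorem Normal.corrSignal_eq_pend {P : Pattern V} (h : Normal StdRule P) (he : EntLast P)
    (hs : ∀ c ∈ P, ¬ IsSig c) (j : V) :
    corrXSignal j P = pendX j P ∧ corrZSignal j P = pendZ j P := by
  induction P with
  | nil => simp [pendX, pendZ, corrXSignal, corrZSignal]
  | cons c P ih =>
    have hs' : ∀ c ∈ P, ¬ IsSig c := fun c hc => hs c (by simp [hc])
    have := ih h.of_cons he.of_cons hs'
    cases c with
    | meas i β s t =>
      have := pend_eq_empty (h.not_isCorr_of_meas he.of_cons hs') j
      simp_all [pendX, pendZ, corrXSignal, corrZSignal]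
    | _ => simp_all [pendX, pendZ, corrXSignal, corrZSignal]

/-- No corrections are left to absorb in a normal form, so the invariants `recX`, `recZ` are the
actual signals. -/
theorem Normal.signals_eq_rec {P : Pattern V} (h : Normal StdRule P) (he : EntLast P)
    (hs : ∀ c ∈ P, ¬ IsSig c) (hc : Causal P) {i : V} {β : Real.Angle} {s t : Signal V}
    (hi : meas i β s t ∈ P) : s = recX i P ∧ t = recZ i P := by
  induction P with
  | nil => simp at hi
  | cons c P ih =>
    have hs' : ∀ c ∈ P, ¬ IsSig c := fun c hc => hs c (by simp [hc])
    rcases List.mem_cons.1 hi with rfl | hi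
    · have := pend_eq_empty (h.not_isCorr_of_meas he.of_cons hs') i
      simp [recX, recZ, this, ← Finset.bot_eq_empty]
    · have := ih h.of_cons he.of_cons hs' hc.of_cons hi
      have hm : i ∈ measured P := mem_measured.2 ⟨_, _, _, hi⟩
      cases c with
      | meas k γ s' t' =>
        have : k ≠ i := by rintro rfl; exact hc.1 hm
        simp_all [recX, recZ]
      | _ => simp_all [recX, recZ]

end Standardization

/-! ### Signals in the pattern of a flow -/

section FlowPattern

variable {V : Type*} [Fintype V] [DecidableEq V] (G : SimpleGraph V) [DecidableRel G.Adj]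
  (α : V → Real.Angle) (f : V → V)

omit [Fintype V] in
theorem corrZ_map_append (K : List V) (i : V) (P : Pattern V) :
    measured (K.map (fun k => corrZ k {i}) ++ P) = measured P ∧
    (∀ j, pendX j (K.map (fun k => corrZ k {i}) ++ P) = pendX j P) ∧
    (∀ j, recX j (K.map (fun k => corrZ k {i}) ++ P) = recX j P) ∧
    (∀ j, recZ j (K.map (fun k => corrZ k {i}) ++ P) = recZ j P) ∧
    (i ∈ measured P → Causal P → Causal (K.map (fun k => corrZ k {i}) ++ P)) := by
  induction K with
  | nil => simp
  | cons k K ih => simp_all [measured, pendX, recX, recZ, Causal]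

omit [Fintype V] in
theorem pendZ_corrZ_map_append {K : List V} (hK : K.Nodup) (i j : V) (P : Pattern V) :
    pendZ j (K.map (fun k => corrZ k {i}) ++ P) =
      if j ∈ K then {i} ∆ pendZ j P else pendZ j P := by
  induction K with
  | nil => simp
  | cons k K ih =>
    have := List.nodup_cons.1 hK
    have := ih this.2
    by_cases hk : k = j <;> simp_all [pendZ]
    simp [Ne.symm hk]

theorem measured_flowBlock_append (i : V) (P : Pattern V) :
    measured (flowBlock G α f i ++ P) = insert i (measured P) := by
  unfold flowBlock
  split_ifs <;> simp [measured, (corrZ_map_append _ _ _).1]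

theorem rec_flowBlock_append (i : V) (P : Pattern V) (j : V) :
    recX j (flowBlock G α f i ++ P) = (if i = j then pendX j P else recX j P) ∧
    recZ j (flowBlock G α f i ++ P) = (if i = j then pendZ j P else recZ j P) := by
  unfold flowBlock
  split_ifs <;> simp [recX, recZ, (corrZ_map_append _ _ _).2.2.1, (corrZ_map_append _ _ _).2.2.2.1,
    *]

theorem causal_flowBlock_append {i : V} {P : Pattern V} (hi : i ∉ measured P) (hP : Causal P) :
    Causal (flowBlock G α f i ++ P) := by
  have := (corrZ_map_append ((G.neighborFinset (f i)).erase i).toList i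
    (meas i (α i) ∅ ∅ :: P)).2.2.2.2 (by simp [measured]) (by simp [Causal, hi, hP])
  unfold flowBlock
  split_ifs <;> simp [measured, (corrZ_map_append _ _ _).1, Causal, this]

theorem pendX_flowBlock_append (i : V) (P : Pattern V) (j : V) :
    pendX j (flowBlock G α f i ++ P) =
      if i = j then ∅ else if f i = j then {i} ∆ pendX j P else pendX j P := by
  unfold flowBlock
  by_cases h1 : f i = i <;> by_cases h2 : i = j <;> by_cases h3 : f i = j <;>
    simp_all [pendX, (corrZ_map_append _ _ _).2.1]

theorem pendZ_flowBlock_append (i : V) (P : Pattern V) (j : V) :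
    pendZ j (flowBlock G α f i ++ P) =
      if i = j then ∅ else if G.Adj (f i) j then {i} ∆ pendZ j P else pendZ j P := by
  unfold flowBlock
  have := pendZ_corrZ_map_append (Finset.nodup_toList ((G.neighborFinset (f i)).erase i)) i j
    (meas i (α i) ∅ ∅ :: P)
  by_cases h1 : f i = i <;> by_cases h2 : i = j <;> by_cases h3 : G.Adj (f i) j <;>
    simp_all [pendZ]
  all_goals simp_all [eq_comm]

/-- The pattern of a list of measured qubits (the last one is measured first). -/
noncomputable def listPattern (L : List V) : Pattern V :=
  L.flatMap (flowBlock G α f) ++ G.edgeFinset.toList.map ent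

omit [Fintype V] in
theorem ents_properties (E : List (Sym2 V)) :
    measured (E.map ent) = ∅ ∧ Causal (E.map ent) ∧
    ∀ j, pendX j (E.map ent) = ∅ ∧ pendZ j (E.map ent) = ∅ := by
  induction E with
  | nil => simp [measured, Causal, pendX, pendZ]
  | cons e E ih => simpa [measured, Causal, pendX, pendZ] using ih

theorem listPattern_cons (i : V) (L : List V) :
    listPattern G α f (i :: L) = flowBlock G α f i ++ listPattern G α f L := by
  simp [listPattern]

theorem measured_listPattern (L : List V) : measured (listPattern G α f L) = L.toFinset := by
  induction L with
  | nil => simp [listPattern, ents_properties]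
  | cons i L ih => simp [listPattern_cons, measured_flowBlock_append, ih]

theorem causal_listPattern {L : List V} (hL : L.Nodup) : Causal (listPattern G α f L) := by
  induction L with
  | nil => simp [listPattern, ents_properties]
  | cons i L ih =>
    rw [List.nodup_cons] at hL
    rw [listPattern_cons]
    exact causal_flowBlock_append G α f (by simpa [measured_listPattern] using hL.1) (ih hL.2)

omit [Fintype V] in
theorem singleton_symmDiff_of_not_mem {i : V} {s : Finset V} (h : i ∉ s) :
    ({i} : Finset V) ∆ s = insert i s := by
  ext x
  by_cases hx : x = i <;> simp_all [Finset.mem_symmDiff]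

/-- No measurement of `j` absorbs corrections, and the outcomes that control them are distinct, so
nothing cancels in the symmetric differences. -/
theorem pend_listPattern_of_not_mem {L : List V} (hL : L.Nodup) {j : V} (hj : j ∉ L) :
    pendX j (listPattern G α f L) = {i ∈ L.toFinset | i ≠ j ∧ f i = j} ∧
    pendZ j (listPattern G α f L) = {i ∈ L.toFinset | i ≠ j ∧ G.Adj (f i) j} := by
  induction L with
  | nil => simp [listPattern, ents_properties]
  | cons i L ih =>
    simp only [List.mem_cons, not_or] at hj
    rw [List.nodup_cons] at hL
    obtain ⟨h1, h2⟩ := ih hL.2 hj.2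
    rw [listPattern_cons, pendX_flowBlock_append, pendZ_flowBlock_append, h1, h2,
      if_neg (Ne.symm hj.1), if_neg (Ne.symm hj.1), List.toFinset_cons, Finset.filter_insert,
      Finset.filter_insert, singleton_symmDiff_of_not_mem (by simp [hL.1]),
      singleton_symmDiff_of_not_mem (by simp [hL.1])]
    simp [Ne.symm hj.1]

/-- Each vertex of the list corrects only vertices before it in the list. -/
def CorrectsLeft (L : List V) : Prop := L.Pairwise fun x y => f x ≠ y ∧ ¬ G.Adj (f x) y

variable {G f}

theorem pend_listPattern_of_mem {L : List V} (hL : L.Nodup) (hc : CorrectsLeft G f L) {j : V}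
    (hj : j ∈ L) :
    pendX j (listPattern G α f L) = ∅ ∧ pendZ j (listPattern G α f L) = ∅ := by
  induction L with
  | nil => simp at hj
  | cons i L ih =>
    rw [List.nodup_cons] at hL
    have hc' := List.pairwise_cons.1 hc
    rw [listPattern_cons, pendX_flowBlock_append, pendZ_flowBlock_append]
    by_cases hij : i = j
    · simp [hij]
    · have hj : j ∈ L := by simpa [Ne.symm hij] using hj
      have := hc'.1 j hj
      simp [hij, this, ih hL.2 hc'.2 hj]

/-- The measurement of `j` absorbs the corrections from the vertices behind it in the list; those in
front of it do not correct `j`, by `CorrectsLeft`. -/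
theorem rec_listPattern {L : List V} (hL : L.Nodup) (hc : CorrectsLeft G f L) {j : V}
    (hj : j ∈ L) :
    recX j (listPattern G α f L) = {i ∈ L.toFinset | i ≠ j ∧ f i = j} ∧
    recZ j (listPattern G α f L) = {i ∈ L.toFinset | i ≠ j ∧ G.Adj (f i) j} := by
  induction L with
  | nil => simp at hj
  | cons i L ih =>
    rw [List.nodup_cons] at hL
    have hc' := List.pairwise_cons.1 hc
    have h := rec_flowBlock_append G α f i (listPattern G α f L) j
    rw [listPattern_cons, h.1, h.2, List.toFinset_cons, Finset.filter_insert,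
      Finset.filter_insert]
    by_cases hij : i = j
    · subst hij
      have := pend_listPattern_of_not_mem G α f hL.2 hL.1
      simp [this]
    · have hj : j ∈ L := by simpa [Ne.symm hij] using hj
      have := hc'.1 j hj
      simp [hij, this, ih hL.2 hc'.2 hj]

theorem mem_flowBlock {i : V} {c : Command V} (hc : c ∈ flowBlock G α f i) :
    ¬ IsEnt c ∧ ¬ IsSig c ∧ ∀ k β s t, c = meas k β s t → β = α k := by
  unfold flowBlock at hc
  simp only [List.mem_append, List.mem_map, List.mem_singleton] at hc
  rcases hc with (hc | ⟨k, -, rfl⟩) | rfl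
  · split_ifs at hc
    · simp at hc
    · rw [List.mem_singleton] at hc
      subst hc
      simp [IsEnt, IsSig]
  · simp [IsEnt, IsSig]
  · simp only [IsEnt, IsSig, not_false_eq_true, true_and]
    rintro k β s t h
    injection h with h1 h2
    rw [← h1, ← h2]

theorem stdInv_listPattern {L : List V} (hL : L.Nodup) :
    StdInv α (listPattern G α f L) (listPattern G α f L) := by
  refine ⟨⟨causal_listPattern G α f hL, ?_, ?_⟩, ⟨rfl, fun _ => rfl, fun _ => rfl, fun _ => rfl,
    fun _ => rfl⟩, ?_⟩
  · unfold EntLast listPattern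
    rw [List.pairwise_append]
    refine ⟨?_, ?_, ?_⟩
    · refine List.Pairwise.imp_of_mem (R := fun _ _ => True) ?_
        (List.pairwise_of_forall fun _ _ => trivial)
      intro c d hc _ _ h
      obtain ⟨i, -, hi⟩ := List.mem_flatMap.1 hc
      exact ((mem_flowBlock α hi).1 h).elim
    · rw [List.pairwise_map]
      exact List.pairwise_of_forall fun _ _ _ => trivial
    · intro c _ d hd _
      obtain ⟨e, -, rfl⟩ := List.mem_map.1 hd
      trivial
  · intro i β s t h
    rcases List.mem_append.1 h with h | h
    · obtain ⟨k, -, hk⟩ := List.mem_flatMap.1 h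
      exact (mem_flowBlock α hk).2.2 _ _ _ _ rfl
    · simp at h
  · intro c h
    rcases List.mem_append.1 h with h | h
    · obtain ⟨k, -, hk⟩ := List.mem_flatMap.1 h
      exact (mem_flowBlock α hk).2.1
    · obtain ⟨e, -, rfl⟩ := List.mem_map.1 h
      simp [IsSig]

end FlowPattern

/-! ### The dependencies after standardization -/

section Dependencies

variable {V : Type*} [Fintype V] [DecidableEq V] (G : SimpleGraph V) [DecidableRel G.Adj]
  (O : Finset V) (f : V → V)

/-- The qubits whose measurement is followed by an `X` correction on `j`. -/
def xDeps (j : V) : Finset V := {i | i ∉ O ∧ i ≠ j ∧ f i = j}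

/-- The qubits whose measurement is followed by a `Z` correction on `j`. -/
def zDeps (j : V) : Finset V := {i | i ∉ O ∧ i ≠ j ∧ G.Adj (f i) j}

variable {G O f}

theorem mem_xDeps {i j : V} : i ∈ xDeps O f j ↔ i ∉ O ∧ i ≠ j ∧ f i = j := by simp [xDeps]

theorem mem_zDeps {i j : V} : i ∈ zDeps G O f j ↔ i ∉ O ∧ i ≠ j ∧ G.Adj (f i) j := by
  simp [zDeps]

theorem listPattern_standardized {α : V → Real.Angle} {L : List V} (hL : L.Nodup)
    (hO : ∀ x, x ∈ L ↔ x ∉ O) (hc : CorrectsLeft G f L) {Q : Pattern V}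
    (hQ : IsNormalFormOf StdRule (listPattern G α f L) Q) :
    WellFormed α Q ∧ (∀ c ∈ Q, ¬ IsSig c) ∧ measured Q = Oᶜ ∧
    (∀ j β s t, meas j β s t ∈ Q → s = xDeps O f j ∧ t = zDeps G O f j) ∧
    (∀ j, corrXSignal j Q = if j ∈ O then xDeps O f j else ∅) ∧
    (∀ j, corrZSignal j Q = if j ∈ O then zDeps G O f j else ∅) := by
  have h : StdInv α (listPattern G α f L) Q :=
    hQ.invariant (fun _ _ _ _ => StdInv.step) (stdInv_listPattern α hL)
  have hn : Normal StdRule Q := hQ.2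
  have hm : measured Q = Oᶜ := by
    rw [← h.stdEq.measured, measured_listPattern]
    ext x
    simp [hO]
  have hx (j) : ({i ∈ L.toFinset | i ≠ j ∧ f i = j} : Finset V) = xDeps O f j := by
    ext x
    simp [xDeps, hO]
  have hz (j) : ({i ∈ L.toFinset | i ≠ j ∧ G.Adj (f i) j} : Finset V) = zDeps G O f j := by
    ext x
    simp [zDeps, hO]
  refine ⟨h.toWellFormed, h.notSig, hm, fun j β s t hj => ?_, fun j => ?_, fun j => ?_⟩
  · have hj' : j ∈ L := by
      have : j ∈ measured Q := mem_measured.2 ⟨_, _, _, hj⟩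
      simpa [hm, hO] using this
    obtain ⟨h1, h2⟩ := hn.signals_eq_rec h.entLast h.notSig h.causal hj
    obtain ⟨h3, h4⟩ := rec_listPattern α hL hc hj'
    rw [h1, h2, ← h.stdEq.recX, ← h.stdEq.recZ, h3, h4, hx, hz]
    exact ⟨rfl, rfl⟩
  all_goals
    obtain ⟨h1, h2⟩ := hn.corrSignal_eq_pend h.entLast h.notSig j
    simp only [h1, h2, ← h.stdEq.pendX, ← h.stdEq.pendZ]
    split_ifs with hj
    · have := pend_listPattern_of_not_mem G α f hL (j := j) (by simpa [hO] using hj)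
      simp only [this, hx, hz]
    · have := pend_listPattern_of_mem α hL hc (j := j) (by simpa [hO] using hj)
      simp only [this]

end Dependencies

/-! ### Invariants of Pauli simplification -/

section Pauli

variable {V : Type*} [DecidableEq V]

theorem not_isYAngle_of_isXAngle {a : Real.Angle} (h : IsXAngle a) : ¬ IsYAngle a := by
  intro h'
  have h1 : a.cos ≠ 0 := by rcases h with rfl | rfl <;> simp
  have h2 : a.cos = 0 := by rcases h' with rfl | rfl <;> simp [Real.cos_pi_div_two]
  exact h1 h2

open Classical in
/-- The `X`-dependency after Pauli simplification, for the dependency `s` before. -/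
noncomputable def pauliX (a : Real.Angle) (s : Signal V) : Signal V :=
  if IsPauliAngle a then ∅ else s

open Classical in
/-- The `Z`-dependency after Pauli simplification, for the dependencies `s`, `t` before. -/
noncomputable def pauliZ (a : Real.Angle) (s t : Signal V) : Signal V :=
  if IsYAngle a then s ∆ t else t

theorem mem_of_mem_pauliZ {a : Real.Angle} {s t : Finset V} {i : V} (h : i ∈ pauliZ a s t) :
    i ∈ s ∨ i ∈ t := by
  unfold pauliZ at h
  split_ifs at h
  · rcases Finset.mem_symmDiff.1 h with h | h
    · exact .inl h.1
    · exact .inr h.1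
  · exact .inr h

theorem corrSignal_append (A P : Pattern V) (j : V) :
    corrXSignal j (A ++ P) = corrXSignal j A ∆ corrXSignal j P ∧
    corrZSignal j (A ++ P) = corrZSignal j A ∆ corrZSignal j P := by
  induction A with
  | nil => simp [corrXSignal, corrZSignal, ← Finset.bot_eq_empty]
  | cons c A ih =>
    cases c <;> simp [corrXSignal, corrZSignal, ih] <;> split_ifs <;> simp [symmDiff_assoc]

/-- What Pauli simplification preserves, starting from `P`; `X` and `Z` are the dependencies of
the measurements in `P`. -/
structure PauliInv (α : V → Real.Angle) (X Z : V → Signal V) (P Q : Pattern V) : Prop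
    extends WellFormed α Q where
  notSig : ∀ c ∈ Q, ¬ IsSig c
  measured : measured Q = measured P
  corrX : ∀ j, corrXSignal j Q = corrXSignal j P
  corrZ : ∀ j, corrZSignal j Q = corrZSignal j P
  deps : ∀ j β s t, meas j β s t ∈ Q →
    (s = X j ∧ t = Z j) ∨ (s = pauliX β (X j) ∧ t = pauliZ β (X j) (Z j))

theorem PauliInv.step {α : V → Real.Angle} {X Z : V → Signal V} {P A B l r : Pattern V}
    (hr : PauliRule l r) (h : PauliInv α X Z P (A ++ l ++ B)) :
    PauliInv α X Z P (A ++ r ++ B) := by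
  -- Both rules are treated at once: they change the signals of one measurement and introduce no new
  -- outcomes. They apply only to an unsimplified measurement, because simplification leaves an
  -- empty X-signal at Pauli angles.
  obtain ⟨i, β, s, t, s', t', rfl, rfl, hs, hβ⟩ : ∃ i β s t s' t', l = [meas i β s t] ∧
      r = [meas i β s' t'] ∧ (∀ u : Finset V, s ⊆ u → t ⊆ u → s' ⊆ u ∧ t' ⊆ u) ∧
      ((s = X i ∧ t = Z i) ∨ (s = pauliX β (X i) ∧ t = pauliZ β (X i) (Z i)) →
        (s' = pauliX β (X i) ∧ t' = pauliZ β (X i) (Z i))) := by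
    cases hr with
    | dropX i β s t hβ hs =>
      refine ⟨i, β, s, t, ∅, t, rfl, rfl, fun u _ h => ⟨by simp, h⟩, ?_⟩
      rintro (h | h)
      · simp [pauliX, pauliZ, IsPauliAngle, hβ, not_isYAngle_of_isXAngle hβ, h]
      · simp [pauliX, IsPauliAngle, hβ] at h
        exact (hs h.1).elim
    | turnY i β s t hβ hs =>
      refine ⟨i, β, s, t, ∅, s ∆ t, rfl, rfl,
        fun u h h' => ⟨by simp, symmDiff_subset_of_subset h h'⟩, ?_⟩
      rintro (h | h)
      · simp [pauliX, pauliZ, IsPauliAngle, hβ, h]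
      · simp [pauliX, IsPauliAngle, hβ] at h
        exact (hs h.1).elim
  refine ⟨h.append_congr (by simp) (by simp [IsEnt]) (by simp [IsEnt]) (by simp [MBQC.measured])
    ?_ (by simp +contextual), ?_, ?_, ?_, ?_, ?_⟩
  · simp only [List.cons_append, List.nil_append, Causal]
    exact fun hc => ⟨hc.1, (hs _ hc.2.1 hc.2.2.1).1, (hs _ hc.2.1 hc.2.2.1).2, hc.2.2.2⟩
  · intro c hc
    have := h.notSig c
    simp only [List.mem_append, List.mem_singleton] at hc this
    rcases hc with (hc | rfl) | hc
    · simp_all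
    · simp [IsSig]
    · simp_all
  · rw [← h.measured]
    simp [measured_append, MBQC.measured]
  · intro j
    rw [← h.corrX]
    simp [corrSignal_append, corrXSignal]
  · intro j
    rw [← h.corrZ]
    simp [corrSignal_append, corrZSignal]
  · intro j γ u v hj
    simp only [List.mem_append, List.mem_singleton] at hj
    rcases hj with (hj | hj) | hj
    · exact h.deps j γ u v (by simp [hj])
    · injection hj with h1 h2 h3 h4
      subst h1 h2 h3 h4
      exact .inr (hβ (h.deps j γ s t (by simp)))
    · exact h.deps j γ u v (by simp [hj])

theorem PauliInv.deps_of_normal {α : V → Real.Angle} {X Z : V → Signal V} {P Q : Pattern V}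
    (h : PauliInv α X Z P Q) (hn : Normal PauliRule Q) {j : V} {β : Real.Angle} {s t : Signal V}
    (hj : meas j β s t ∈ Q) : s = pauliX β (X j) ∧ t = pauliZ β (X j) (Z j) := by
  have hs : IsPauliAngle β → s = ∅ := by
    intro hβ
    by_contra hs
    obtain ⟨A, B, rfl⟩ := List.append_of_mem hj
    have key : ∀ r, ¬ PauliRule [meas j β s t] r := fun r =>
      Normal.not_rule (A := A) (B := B) (by simpa using hn) r
    rcases hβ with hβ | hβ
    · exact key _ (.dropX j β s t hβ hs)
    · exact key _ (.turnY j β s t hβ hs)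
  rcases h.deps j β s t hj with ⟨h1, h2⟩ | h'
  -- An untouched Pauli measurement in a normal form already had an empty X-signal, so
  -- simplification would not change it.
  · by_cases hβ : IsPauliAngle β
    · have := hs hβ
      subst this
      simp [pauliX, pauliZ, hβ, h2, ← h1, ← Finset.bot_eq_empty]
    · have : ¬ IsYAngle β := fun h => hβ (.inr h)
      simp [pauliX, pauliZ, hβ, h1, h2, this]
  · exact h'

end Pauli

/-! ### Signal shifting as a change of variables modulo 2 -/

section Shifting

variable {V : Type*}

/-- The value of a signal, given the values of the outcomes. -/
def ev (φ : V → ZMod 2) (u : Signal V) : ZMod 2 := ∑ i ∈ u, φ i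

@[simp] theorem ev_empty (φ : V → ZMod 2) : ev φ ∅ = 0 := Finset.sum_empty

theorem exists_ne_zero_of_ev {φ : V → ZMod 2} {u : Finset V} (h : ev φ u ≠ 0) :
    ∃ i ∈ u, φ i ≠ 0 := Finset.exists_ne_zero_of_sum_ne_zero h

variable [DecidableEq V]

theorem ev_symmDiff (φ : V → ZMod 2) (s t : Signal V) : ev φ (s ∆ t) = ev φ s + ev φ t := by
  unfold ev
  rw [← Finset.sum_inter_add_sum_sdiff s t φ, ← Finset.sum_inter_add_sum_sdiff t s φ,
    Finset.inter_comm t s, symmDiff_def, Finset.sup_eq_union,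
    Finset.sum_union disjoint_sdiff_sdiff]
  linear_combination -CharTwo.add_self_eq_zero (∑ x ∈ s ∩ t, φ x)

theorem ev_update_of_notMem (φ : V → ZMod 2) {i : V} {s : Signal V} (h : i ∉ s) (a : ZMod 2) :
    ev (Function.update φ i a) s = ev φ s :=
  Finset.sum_congr rfl fun k hk => Function.update_of_ne (by rintro rfl; exact h hk) _ _

theorem ev_shift (φ : V → ZMod 2) (s : Signal V) (i : V) (t : Signal V) :
    ev φ (s.shift i t) = ev (Function.update φ i (φ i + ev φ t)) s := by
  unfold Signal.shift
  split_ifs with h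
  · rw [ev_symmDiff]
    unfold ev
    rw [Finset.sum_update_of_mem h, ← Finset.add_sum_erase s φ h, Finset.sdiff_singleton_eq_erase]
    ring
  · rw [ev_update_of_notMem φ h]

/-- This recovers a signal from its values: it suffices to know them on indicator vectors. -/
theorem mem_iff_ev_eq_one (k : V) (s : Signal V) :
    k ∈ s ↔ ev (fun i => if i = k then 1 else 0) s = 1 := by
  simp [ev]

/-- The measurement outcomes after executing a pattern, as modified by signal shifting, where
`r i` would be the outcome of the measurement of `i` without its `Z`-dependency. -/
def outcome (r : V → ZMod 2) : Pattern V → V → ZMod 2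
  | [] => r
  | meas i _ _ t :: P => Function.update (outcome r P) i (r i + ev (outcome r P) t)
  | sig i t :: P => Function.update (outcome r P) i (outcome r P i + ev (outcome r P) t)
  | _ :: P => outcome r P

/-- The value of the `X`-dependency of the measurement of `j`. -/
def measXValue (r : V → ZMod 2) (j : V) : Pattern V → ZMod 2
  | [] => 0
  | meas i _ s _ :: P => if i = j then ev (outcome r P) s else measXValue r j P
  | _ :: P => measXValue r j P

/-- The value of the signal of the `X` correction on `j`. -/
def corrXValue (r : V → ZMod 2) (j : V) : Pattern V → ZMod 2
  | [] => 0
  | corrX i s :: P => if i = j then ev (outcome r P) s + corrXValue r j P else corrXValue r j P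
  | _ :: P => corrXValue r j P

/-- The value of the signal of the `Z` correction on `j`. -/
def corrZValue (r : V → ZMod 2) (j : V) : Pattern V → ZMod 2
  | [] => 0
  | corrZ i s :: P => if i = j then ev (outcome r P) s + corrZValue r j P else corrZValue r j P
  | _ :: P => corrZValue r j P

/-- Two patterns that agree up to signal shifting. -/
structure ShiftEq (P Q : Pattern V) : Prop where
  measured : measured P = measured Q
  outcome : ∀ r, outcome r P = outcome r Q
  measX : ∀ r j, measXValue r j P = measXValue r j Q
  corrX : ∀ r j, corrXValue r j P = corrXValue r j Q
  corrZ : ∀ r j, corrZValue r j P = corrZValue r j Q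

theorem ShiftEq.trans {P Q R : Pattern V} (h : ShiftEq P Q) (h' : ShiftEq Q R) : ShiftEq P R :=
  ⟨h.1.trans h'.1, fun r => (h.2 r).trans (h'.2 r), fun r j => (h.3 r j).trans (h'.3 r j),
    fun r j => (h.4 r j).trans (h'.4 r j), fun r j => (h.5 r j).trans (h'.5 r j)⟩

theorem ShiftEq.append {P Q : Pattern V} (h : ShiftEq P Q) (A : Pattern V) :
    ShiftEq (A ++ P) (A ++ Q) := by
  induction A with
  | nil => exact h
  | cons c A ih =>
    obtain ⟨h1, h2, h3, h4, h5⟩ := ih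
    cases c <;> constructor <;>
      simp_all [MBQC.measured, MBQC.outcome, measXValue, corrXValue, corrZValue]

/-- Substituting `s_i + t` for `s_i` is evaluation at the updated outcomes (`ev_shift`). Causality
keeps a qubit out of its own signals and makes the two updates in `passMeas` commute. -/
theorem ShiftRule.shiftEq {l r : Pattern V} (h : ShiftRule l r) (B : Pattern V)
    (hB : Causal (l ++ B)) : ShiftEq (l ++ B) (r ++ B) := by
  cases h with
  | extract i α s t ht =>
    simp only [List.cons_append, List.nil_append, Causal] at hB
    have : i ∉ t := fun h => hB.1 (hB.2.2.1 h)
    constructor <;> intros <;>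
      simp [measured, outcome, measXValue, corrXValue, corrZValue, ev_update_of_notMem, this]
  | passX i j s t =>
    constructor <;> intros <;>
      simp [measured, outcome, measXValue, corrXValue, corrZValue, ev_shift]
  | passZ i j s t =>
    constructor <;> intros <;>
      simp [measured, outcome, measXValue, corrXValue, corrZValue, ev_shift]
  | passMeas i j α s t q =>
    simp only [List.cons_append, List.nil_append, Causal, measured] at hB
    have h1 : j ∉ q := fun h => hB.1 (hB.2.2.2.2.1 h)
    have h2 : i ≠ j := by rintro rfl; exact hB.1 hB.2.2.2.1
    constructor <;> intros <;>
      simp [measured, outcome, measXValue, corrXValue, corrZValue, ev_shift, ev_update_of_notMem,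
        h1, h2]
    rw [Function.update_comm h2]

theorem ShiftRule.causal {l r : Pattern V} (h : ShiftRule l r) (B : Pattern V)
    (hB : Causal (l ++ B)) : Causal (r ++ B) := by
  cases h with
  | extract i α s t ht =>
    simp_all [Causal, measured]
    exact hB.2.2.1.trans (Finset.subset_insert _ _)
  | passX | passZ => simp_all [Causal, measured, shift_subset_of_subset]
  | passMeas =>
    simp_all [Causal, measured, shift_subset_of_subset]
    exact hB.2.2.2.2.1.trans (Finset.subset_insert _ _)

/-- What signal shifting preserves, starting from `P`. -/
structure ShiftInv (α : V → Real.Angle) (P Q : Pattern V) : Prop extends WellFormed α Q where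
  shiftEq : ShiftEq P Q

theorem ShiftInv.step {α : V → Real.Angle} {P A B l r : Pattern V} (hr : ShiftRule l r)
    (h : ShiftInv α P (A ++ l ++ B)) : ShiftInv α P (A ++ r ++ B) := by
  have hB : Causal (l ++ B) := Causal.of_append (A := A) (by simpa using h.causal)
  have he := hr.shiftEq B hB
  refine ⟨h.append_congr ?_ ?_ ?_ he.measured (hr.causal B) ?_, ?_⟩
  · cases hr <;> simp
  · cases hr <;> simp [IsEnt]
  · cases hr <;> simp [IsEnt]
  · intro i β s t hi
    cases hr <;> simp_all
  · have := h.shiftEq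
    rw [List.append_assoc] at this ⊢
    exact this.trans (he.append A)

/-- Shifting commands pass measurements and corrections, and `EntLast` keeps entanglement from
blocking them, so in a normal form they are all at the left end. -/
theorem Normal.not_isSig_of_cons {c : Command V} {P : Pattern V}
    (h : Normal ShiftRule (c :: P)) (he : EntLast (c :: P)) (hc : ¬ IsSig c) :
    ∀ d ∈ P, ¬ IsSig d := by
  induction P generalizing c with
  | nil => simp
  | cons d P ih =>
    have key : ∀ r, ¬ ShiftRule [c, d] r := fun r =>
      Normal.not_rule (A := []) (l := [_, _]) (B := P) h r
    have hd : ¬ IsSig d := by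
      intro hd
      have := (List.pairwise_cons.1 he).1 d (by simp)
      cases d with
      | sig k t =>
        cases c with
        | ent e => exact this trivial
        | meas i β s t => exact key _ (.passMeas ..)
        | corrX i s => exact key _ (.passX ..)
        | corrZ i s => exact key _ (.passZ ..)
        | sig i t => exact hc trivial
      | _ => exact hd
    intro e h'
    rcases List.mem_cons.1 h' with rfl | h'
    · exact hd
    · exact ih h.of_cons he.of_cons hd e h'

theorem Normal.zDep_eq_empty {P : Pattern V} (h : Normal ShiftRule P) {j : V} {β : Real.Angle}
    {s t : Signal V} (hj : meas j β s t ∈ P) : t = ∅ := by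
  by_contra ht
  obtain ⟨A, B, rfl⟩ := List.append_of_mem hj
  exact Normal.not_rule (R := ShiftRule) (A := A) (l := [meas j β s t]) (B := B)
    (by simpa using h) _ (.extract j β s t ht)

theorem Normal.outcome_eq {P : Pattern V} (h : Normal ShiftRule P) (hs : ∀ c ∈ P, ¬ IsSig c)
    (r : V → ZMod 2) : outcome r P = r := by
  induction P with
  | nil => rfl
  | cons c P ih =>
    have := ih h.of_cons fun c hc => hs c (by simp [hc])
    cases c with
    | meas i β s t =>
      have ht := h.zDep_eq_empty (j := i) (β := β) (s := s) (t := t) (by simp)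
      simp [outcome, this, ht]
    | sig i t => exact (hs (sig i t) (by simp) trivial).elim
    | _ => simpa [outcome] using this

theorem Normal.measXValue_eq {P : Pattern V} (h : Normal ShiftRule P) (he : EntLast P)
    (hc : Causal P) (r : V → ZMod 2) {j : V} {β : Real.Angle} {s t : Signal V}
    (hj : meas j β s t ∈ P) : measXValue r j P = ev r s := by
  induction P with
  | nil => simp at hj
  | cons c P ih =>
    rcases List.mem_cons.1 hj with rfl | hj
    · simp [measXValue, h.of_cons.outcome_eq (h.not_isSig_of_cons he (by simp [IsSig]))]
    · have := ih h.of_cons he.of_cons hc.of_cons hj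
      have hm : j ∈ measured P := mem_measured.2 ⟨_, _, _, hj⟩
      cases c with
      | meas k γ s' t' =>
        have : k ≠ j := by rintro rfl; exact hc.1 hm
        simp_all [measXValue]
      | _ => simp_all [measXValue]

theorem Normal.corrValue_eq {P : Pattern V} (h : Normal ShiftRule P) (he : EntLast P)
    (r : V → ZMod 2) (j : V) :
    corrXValue r j P = ev r (corrXSignal j P) ∧ corrZValue r j P = ev r (corrZSignal j P) := by
  induction P with
  | nil => simp [corrXValue, corrZValue, corrXSignal, corrZSignal]
  | cons c P ih =>
    have := ih h.of_cons he.of_cons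
    have h' : ¬ IsSig c → outcome r P = r := fun hc =>
      h.of_cons.outcome_eq (h.not_isSig_of_cons he hc) r
    cases c <;> simp_all [corrXValue, corrZValue, corrXSignal, corrZSignal, IsSig] <;>
      split_ifs <;> simp [ev_symmDiff]

theorem Causal.subset_measured {P : Pattern V} (h : Causal P) {j : V} {β : Real.Angle}
    {s t : Signal V} (hj : meas j β s t ∈ P) : s ⊆ measured P ∧ t ⊆ measured P := by
  obtain ⟨A, B, rfl⟩ := List.append_of_mem hj
  have := h.of_append
  have h' : measured B ⊆ measured (A ++ meas j β s t :: B) := by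
    rw [measured_append, measured]
    exact (Finset.subset_insert _ _).trans Finset.subset_union_right
  exact ⟨this.2.1.trans h', this.2.2.1.trans h'⟩

theorem Causal.corrSignal_subset_measured {P : Pattern V} (h : Causal P) (j : V) :
    corrXSignal j P ⊆ measured P ∧ corrZSignal j P ⊆ measured P := by
  induction P with
  | nil => simp [corrXSignal, corrZSignal]
  | cons c P ih =>
    have := ih h.of_cons
    cases c with
    | meas i β s t =>
      exact ⟨this.1.trans (Finset.subset_insert _ _), this.2.trans (Finset.subset_insert _ _)⟩
    | corrX | corrZ =>
      simp_all [corrXSignal, corrZSignal, Causal, measured]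
      split_ifs
      · exact symmDiff_subset_of_subset h.1 (by tauto)
      · tauto
    | _ => exact this

/-- Later measurements do not alter the outcomes in the signals of `j`, so these may be evaluated at
the final outcomes. This turns the recursion along the pattern into a linear system on the vertices.
-/
theorem Causal.outcome_spec {P : Pattern V} (h : Causal P) (hs : ∀ c ∈ P, ¬ IsSig c)
    (r : V → ZMod 2) {j : V} {β : Real.Angle} {s t : Signal V} (hj : meas j β s t ∈ P) :
    outcome r P j = r j + ev (outcome r P) t ∧ measXValue r j P = ev (outcome r P) s := by
  induction P with
  | nil => simp at hj
  | cons c P ih =>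
    rcases List.mem_cons.1 hj with rfl | hj'
    · have h1 : j ∉ s := fun h' => h.1 (h.2.1 h')
      have h2 : j ∉ t := fun h' => h.1 (h.2.2.1 h')
      simp [measXValue, outcome, ev_update_of_notMem, h1, h2]
    · have := ih h.of_cons (fun c hc => hs c (by simp [hc])) hj'
      have hm : j ∈ measured P := mem_measured.2 ⟨_, _, _, hj'⟩
      cases c with
      | meas k γ s' t' =>
        have h0 : k ≠ j := by rintro rfl; exact h.1 hm
        have h1 : k ∉ s := fun h' => h.1 ((h.of_cons.subset_measured hj').1 h')
        have h2 : k ∉ t := fun h' => h.1 ((h.of_cons.subset_measured hj').2 h')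
        simp [measXValue, outcome, ev_update_of_notMem, h1, h2, h0, h0.symm, this]
      | sig i t => exact (hs (sig i t) (by simp) trivial).elim
      | _ => simpa [measXValue, outcome] using this

theorem Causal.corrValue_spec {P : Pattern V} (h : Causal P) (hs : ∀ c ∈ P, ¬ IsSig c)
    (r : V → ZMod 2) (j : V) : corrXValue r j P = ev (outcome r P) (corrXSignal j P) ∧
      corrZValue r j P = ev (outcome r P) (corrZSignal j P) := by
  induction P with
  | nil => simp [corrXValue, corrZValue, corrXSignal, corrZSignal]
  | cons c P ih =>
    have := ih h.of_cons (fun c hc => hs c (by simp [hc]))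
    cases c with
    | meas k γ s' t' =>
      have h1 : k ∉ corrXSignal j P := fun h' =>
        h.1 ((h.of_cons.corrSignal_subset_measured j).1 h')
      have h2 : k ∉ corrZSignal j P := fun h' =>
        h.1 ((h.of_cons.corrSignal_subset_measured j).2 h')
      simp [corrXValue, corrZValue, corrXSignal, corrZSignal, outcome, ev_update_of_notMem, h1, h2,
        this]
    | sig i t => exact (hs (sig i t) (by simp) trivial).elim
    | corrX | corrZ =>
      simp only [corrXValue, corrZValue, corrXSignal, corrZSignal, outcome, this, true_and,
        and_true]
      split_ifs <;> simp [ev_symmDiff]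
    | _ => exact this

end Shifting

/-! ### The execution digraph as a linear system -/

section Simplification

variable {V : Type*} [Fintype V] [DecidableEq V] {G : SimpleGraph V} [DecidableRel G.Adj]
  {O : Finset V} {f : V → V} {α : V → Real.Angle}

/-- The arcs of the execution digraph after simplification. They are described by vectors `φ`:
`φ i = 1` means that the original outcome of `i` involves the shifted outcome of `k`. -/
theorem execArc_spec {L : List V} (hL : L.Nodup) (hO : ∀ x, x ∈ L ↔ x ∉ O)
    (hc : CorrectsLeft G f L) {Q : Pattern V} (hQ : IsSimplificationOf (listPattern G α f L) Q)
    (k : V) : ∃ φ : V → ZMod 2,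
      (∀ j ∉ O, φ j = (if j = k then 1 else 0) +
        ev φ (pauliZ (α j) (xDeps O f j) (zDeps G O f j))) ∧
      (∀ j ∈ O, ExecArc Q k j ↔ ev φ (xDeps O f j) = 1 ∨ ev φ (zDeps G O f j) = 1) ∧
      (∀ j ∉ O, ExecArc Q k j ↔ ¬ IsPauliAngle (α j) ∧ ev φ (xDeps O f j) = 1) := by
  obtain ⟨P₁, P₂, h₁, h₂, h₃⟩ := hQ
  obtain ⟨hwf, hsig, hm, hd, hX, hZ⟩ := listPattern_standardized hL hO hc h₁
  have hP : PauliInv α (xDeps O f) (zDeps G O f) P₁ P₂ :=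
    h₂.invariant (fun _ _ _ _ => PauliInv.step)
      ⟨hwf, hsig, rfl, fun _ => rfl, fun _ => rfl, fun j β s t hj => .inl (hd j β s t hj)⟩
  have hS : ShiftInv α P₂ Q := h₃.invariant (fun _ _ _ _ => ShiftInv.step)
      ⟨hP.toWellFormed, ⟨rfl, fun _ => rfl, fun _ _ => rfl, fun _ _ => rfl, fun _ _ => rfl⟩⟩
  have hn : Normal ShiftRule Q := h₃.2
  have hmQ : measured Q = Oᶜ := by rw [← hS.shiftEq.measured, hP.measured, hm]
  -- After shifting the outcomes are `r` itself, so this indicator tests whether `k` occurs in a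
  -- signal; before shifting the same values are computed from `φ`.
  set r : V → ZMod 2 := fun i => if i = k then 1 else 0 with hr
  set φ := outcome r P₂ with hφ
  have key (j) (hj : j ∉ O) : ∃ β s t, meas j β s t ∈ P₂ := by
    rw [← mem_measured, hP.measured, hm]
    simpa using hj
  have hcX (j) : k ∈ corrXSignal j Q ↔ j ∈ O ∧ ev φ (xDeps O f j) = 1 := by
    rw [mem_iff_ev_eq_one, ← (hn.corrValue_eq hS.entLast _ j).1, ← hS.shiftEq.corrX,
      (hP.causal.corrValue_spec hP.notSig _ j).1, hP.corrX, hX]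
    split_ifs with h <;> simp [h, hφ, hr]
  have hcZ (j) : k ∈ corrZSignal j Q ↔ j ∈ O ∧ ev φ (zDeps G O f j) = 1 := by
    rw [mem_iff_ev_eq_one, ← (hn.corrValue_eq hS.entLast _ j).2, ← hS.shiftEq.corrZ,
      (hP.causal.corrValue_spec hP.notSig _ j).2, hP.corrZ, hZ]
    split_ifs with h <;> simp [h, hφ, hr]
  refine ⟨φ, fun j hj => ?_, fun j hj => ?_, fun j hj => ?_⟩
  · obtain ⟨β, s, t, hm⟩ := key j hj
    rw [hφ, (hP.causal.outcome_spec hP.notSig r hm).1, (hP.deps_of_normal h₂.2 hm).2,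
      hP.angle _ _ _ _ hm]
  · have : ¬ ∃ β s t, meas j β s t ∈ Q := by
      rw [← mem_measured, hmQ]
      simpa using hj
    simp only [ExecArc, hcX, hcZ, hj, true_and]
    refine or_iff_right ?_
    rintro ⟨β, s, t, h, -⟩
    exact this ⟨β, s, t, h⟩
  · have h1 (β s t) (h : meas j β s t ∈ Q) :
        k ∈ s ∨ k ∈ t ↔ ¬ IsPauliAngle (α j) ∧ ev φ (xDeps O f j) = 1 := by
      obtain ⟨β', s', t', h'⟩ := key j hj
      have ht := hn.zDep_eq_empty h
      rw [ht, mem_iff_ev_eq_one, ← hn.measXValue_eq hS.entLast hS.causal _ h, ← hS.shiftEq.measX,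
        (hP.causal.outcome_spec hP.notSig _ h').2, (hP.deps_of_normal h₂.2 h').1,
        hP.angle _ _ _ _ h']
      unfold pauliX
      split_ifs with h <;> simp [h, hφ, hr]
    obtain ⟨β, s, t, h⟩ : ∃ β s t, meas j β s t ∈ Q := by
      rw [← mem_measured, hmQ]
      simpa using hj
    simp only [ExecArc, hcX, hcZ, hj, false_and, or_false]
    constructor
    · rintro ⟨β, s, t, h, h'⟩
      exact (h1 β s t h).1 h'
    · exact fun h' => ⟨β, s, t, h, (h1 β s t h).2 h'⟩

end Simplification

/-! ### Flows with loops and the influence of an outcome -/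

section LoopFlow

variable {V : Type*} [ord : PartialOrder V] {G : SimpleGraph V} {I O : Finset V}
  {α : V → Real.Angle} {f : V → V}

/-- Two vertices with a common neighbour as image precede each other, so antisymmetry applies; a
looped vertex is by definition no other vertex's image. -/
theorem IsLoopFlow.injOn (hf : IsLoopFlow G I O α f ord) {i i' : V} (hi : i ∉ O) (hi' : i' ∉ O)
    (h : f i = f i') : i = i' := by
  rcases hf.adj_or_loop i hi with h1 | ⟨h1, -, h2⟩
  · rcases hf.adj_or_loop i' hi' with h1' | ⟨h1', -, h2'⟩
    · exact le_antisymm (hf.le_nbr i hi i' (h ▸ h1'.symm)) (hf.le_nbr i' hi' i (h ▸ h1.symm))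
    · exact h2' i hi (h.trans h1')
  · exact (h2 i' hi' (h.symm.trans h1)).symm

theorem IsLoopFlow.isYAngle_of_eq (hf : IsLoopFlow G I O α f ord) {i : V} (hi : i ∉ O)
    (h : f i = i) : IsYAngle (α i) := by
  rcases hf.adj_or_loop i hi with h1 | h1
  · rw [h] at h1
    exact (G.irrefl h1).elim
  · exact h1.2.1

theorem IsLoopFlow.adj (hf : IsLoopFlow G I O α f ord) {i : V} (hi : i ∉ O) (h : f i ≠ i) :
    G.Adj i (f i) :=
  (hf.adj_or_loop i hi).resolve_right fun h' => h h'.1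

variable [Fintype V] [DecidableEq V] [DecidableRel G.Adj]

theorem IsLoopFlow.lt_of_mem_deps (hf : IsLoopFlow G I O α f ord) {i j : V}
    (h : i ∈ xDeps O f j ∨ i ∈ zDeps G O f j) : i ∉ O ∧ i < j := by
  rw [mem_xDeps, mem_zDeps] at h
  rcases h with ⟨h1, h2, rfl⟩ | ⟨h1, h2, h3⟩
  · exact ⟨h1, lt_of_le_of_ne (hf.le_image i h1) h2⟩
  · exact ⟨h1, lt_of_le_of_ne (hf.le_nbr i h1 j h3) h2⟩

variable (G O α f) in
/-- `φ` is the influence of the shifted outcome of `k` on the original outcomes. -/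
def IsInfluence (k : V) (φ : V → ZMod 2) : Prop :=
  ∀ j ∉ O, φ j = (if j = k then 1 else 0) + ev φ (pauliZ (α j) (xDeps O f j) (zDeps G O f j))

theorem ZMod.eq_one_of_ne_zero_two : ∀ {a : ZMod 2}, a ≠ 0 → a = 1 := by decide

theorem IsInfluence.le (hf : IsLoopFlow G I O α f ord) {k : V} {φ : V → ZMod 2}
    (hφ : IsInfluence G O α f k φ) {i : V} (hi : i ∉ O) (h : φ i ≠ 0) : k ∉ O ∧ k ≤ i := by
  induction i using WellFoundedLT.induction with
  | _ i ih =>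
    by_cases hik : i = k
    · exact ⟨hik ▸ hi, hik.ge⟩
    · rw [hφ i hi, if_neg hik, zero_add] at h
      obtain ⟨i', hi', h'⟩ := exists_ne_zero_of_ev h
      obtain ⟨h1, h2⟩ := hf.lt_of_mem_deps (mem_of_mem_pauliZ hi')
      obtain ⟨h3, h4⟩ := ih i' h2 h1 h'
      exact ⟨h3, h4.trans h2.le⟩

theorem IsInfluence.self (hf : IsLoopFlow G I O α f ord) {k : V} {φ : V → ZMod 2}
    (hφ : IsInfluence G O α f k φ) (hk : k ∉ O) : φ k = 1 := by
  rw [hφ k hk, if_pos rfl, add_eq_left]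
  by_contra h
  obtain ⟨i, hi, h'⟩ := exists_ne_zero_of_ev h
  obtain ⟨h1, h2⟩ := hf.lt_of_mem_deps (mem_of_mem_pauliZ hi)
  exact h2.not_ge (hφ.le hf h1 h').2

/-- For a maximal `k` of `u`, the influence of `k` lives above `k`, so only the term at `k` survives
in the sum. -/
theorem exists_influence_eq_one (hf : IsLoopFlow G I O α f ord) {u : Finset V} (hu : u.Nonempty)
    (huO : ∀ i ∈ u, i ∉ O) : ∃ k ∈ u, ∀ φ, IsInfluence G O α f k φ → ev φ u = 1 := by
  obtain ⟨k, hk⟩ := u.exists_maximal hu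
  refine ⟨k, hk.1, fun φ hφ => ?_⟩
  rw [ev, Finset.sum_eq_single_of_mem k hk.1, hφ.self hf (huO k hk.1)]
  intro i hi hik
  by_contra h
  have h1 := (hφ.le hf (huO i hi) h).2
  exact hik (le_antisymm (hk.2 hi h1) h1)

/-- Every measured qubit without a loop influences an output. -/
theorem IsInfluence.exists_output (hf : IsLoopFlow G I O α f ord) {j : V} {φ : V → ZMod 2}
    (hφ : IsInfluence G O α f j φ) (hj : j ∉ O) (hfj : f j ≠ j) :
    ∃ v ∈ O, ev φ (xDeps O f v) = 1 ∨ ev φ (zDeps G O f v) = 1 := by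
  by_contra! hno
  -- Among the influenced measured vertices, `i` has maximal image `f i`. If `f i` is an output, its
  -- X-correction signal is `{i}`.
  obtain ⟨i, ⟨hiS, hmax⟩⟩ := Finset.exists_maximalFor f ({i | i ∉ O ∧ φ i ≠ 0} : Finset V)
    ⟨j, by simp [hj, hφ.self hf hj]⟩
  simp only [Finset.mem_filter, Finset.mem_univ, true_and] at hiS hmax
  obtain ⟨hiO, hi⟩ := hiS
  have hmax' {i' : V} (h1 : i' ∉ O) (h2 : φ i' ≠ 0) (h3 : f i ≤ f i') : f i' = f i :=
    le_antisymm (hmax ⟨h1, h2⟩ h3) h3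
  have hi1 : φ i = 1 := ZMod.eq_one_of_ne_zero_two hi
  by_cases hm : f i ∈ O
  · have him : i ≠ f i := fun h => hiO (h ▸ hm)
    refine (hno _ hm).1 ?_
    rw [ev, Finset.sum_eq_single_of_mem i (mem_xDeps.2 ⟨hiO, him, rfl⟩), hi1]
    intro i' hi' hne
    rw [mem_xDeps] at hi'
    exact (hne (hf.injOn hi'.1 hiO hi'.2.2)).elim
  by_cases hloop : f (f i) = f i
  -- If `f i` has a loop, then `i = f i ≠ j` is influenced through some `i'` with `f i' ∼ i`. The
  -- flow condition at the loop gives `i ≼ f i'`, so `f i' = i` by maximality, contradicting `f i' ∼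
  -- i`.
  · have him : f i = i := hf.injOn hm hiO hloop
    have hij : i ≠ j := by
      rintro rfl
      exact hfj him
    have h := hi
    rw [hφ i hiO, if_neg hij, zero_add] at h
    obtain ⟨i', hi', h'⟩ := exists_ne_zero_of_ev h
    rcases mem_of_mem_pauliZ hi' with hx | hz
    · rw [mem_xDeps] at hx
      exact hx.2.1 (hf.injOn hx.1 hiO (hx.2.2.trans him.symm))
    · rw [mem_zDeps] at hz
      have hle : i ≤ f i' := hf.le_nbr i hiO _ (by rw [him]; exact hz.2.2.symm)
      have := hmax' hz.1 h' (by rwa [him])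
      rw [this, him] at hz
      exact G.irrefl hz.2.2
  -- Otherwise consider `v = f (f i)`. Any influenced `i'` in its Z-signal has `f i ≼ f i'`, hence
  -- equals `i`, and none is in its X-signal. So `v` is influenced, with or without a Pauli Y angle,
  -- and `f v` lies strictly above `f i`.
  · have hadj := hf.adj hm hloop
    have hlt : f i < f (f i) := lt_of_le_of_ne (hf.le_image _ hm) (Ne.symm hloop)
    have hiv : i < f (f i) := lt_of_le_of_lt (hf.le_image i hiO) hlt
    have hz : ev φ (zDeps G O f (f (f i))) = 1 := by
      rw [ev, Finset.sum_eq_single_of_mem i (mem_zDeps.2 ⟨hiO, hiv.ne, hadj⟩), hi1]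
      intro i' hi' hne
      rw [mem_zDeps] at hi'
      by_contra h
      exact hne (hf.injOn hi'.1 hiO (hmax' hi'.1 h (hf.le_nbr _ hm _ hi'.2.2.symm)))
    by_cases hv : f (f i) ∈ O
    · exact (hno _ hv).2 hz
    have hx : ev φ (xDeps O f (f (f i))) = 0 := by
      refine Finset.sum_eq_zero fun i' hi' => ?_
      rw [mem_xDeps] at hi'
      by_contra h
      have := hmax' hi'.1 h (by rw [hi'.2.2]; exact hlt.le)
      rw [hi'.2.2] at this
      exact hloop this
    have hvj : f (f i) ≠ j := by
      rintro rfl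
      exact hiv.not_ge (hφ.le hf hiO hi).2
    have hφv : φ (f (f i)) ≠ 0 := by
      rw [hφ _ hv, if_neg hvj, zero_add]
      unfold pauliZ
      split_ifs
      · rw [ev_symmDiff, hx, hz]
        decide
      · rw [hz]
        decide
    have hle := hlt.trans_le (hf.le_image _ hv)
    exact hle.ne' (hmax' hv hφv hle.le)

end LoopFlow

/-! ### Bounds on the quantum depth -/

section Depth

variable {V : Type*}

theorem exists_start_extension [PartialOrder V] [WellFoundedLT V] {R : V → V → Prop}
    (hR : ∀ x y, R x y → x < y) (x : V) (l : List V) (h : (x :: l).IsChain R) :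
    ∃ l', (l' ++ x :: l).IsChain R ∧ ∀ z ∈ (l' ++ x :: l).head?, ∀ y, ¬ R y z := by
  induction x using WellFoundedLT.induction generalizing l with
  | _ x ih =>
    by_cases hx : ∃ y, R y x
    · obtain ⟨y, hy⟩ := hx
      obtain ⟨l', h1, h2⟩ := ih y (hR y x hy) (x :: l) (h.cons_cons hy)
      exact ⟨l' ++ [y], by simpa using h1, by simpa using h2⟩
    · exact ⟨[], h, by simpa using hx⟩

variable [Fintype V] [DecidableEq V]

theorem IsStartEndPath.length_le_quantumDepth {P : Pattern V} {l : List V}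
    (h : IsStartEndPath (ExecArc P) l) : l.length ≤ quantumDepth P := by
  -- The bound on path lengths matters: the supremum of an unbounded set of naturals is 0 by
  -- convention.
  refine le_csSup ⟨Fintype.card V, ?_⟩ ⟨l, h, rfl⟩
  rintro _ ⟨l, hl, rfl⟩
  exact hl.2.1.length_le_card

/-- Depth counts only paths from a start node, so the path is prolonged backwards; arcs increase the
order, so this ends and repeats no vertex. -/
theorem three_le_quantumDepth [PartialOrder V] {P : Pattern V}
    (hR : ∀ x y, ExecArc P x y → x < y) {i j v : V} (hij : ExecArc P i j) (hjv : ExecArc P j v)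
    (hv : ∀ x, ¬ ExecArc P v x) : 3 ≤ quantumDepth P := by
  obtain ⟨l, h1, h2⟩ := exists_start_extension hR i [j, v] (by simp [hij, hjv])
  have hl : IsStartEndPath (ExecArc P) (l ++ [i, j, v]) := by
    refine ⟨by simp, ?_, h1, h2, by simpa using hv⟩
    exact ((h1.imp hR).pairwise).imp fun h => h.ne
  have := hl.length_le_quantumDepth
  simp at this
  omega

theorem quantumDepth_eq_two {P : Pattern V} {O : Finset V}
    (hO : ∀ x y, ExecArc P x y → x ∉ O ∧ y ∈ O) {a b : V} (hab : ExecArc P a b) :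
    quantumDepth P = 2 := by
  apply le_antisymm
  · refine csSup_le' ?_
    rintro _ ⟨l, ⟨-, -, hl, -⟩, rfl⟩
    match l, hl with
    | [], _ | [_], _ | [_, _], _ => simp
    | x :: y :: z :: l, hl =>
      simp only [List.isChain_cons_cons] at hl
      exact ((hO _ _ hl.2.1).1 (hO _ _ hl.1).2).elim
  · have : IsStartEndPath (ExecArc P) [a, b] := by
      have hne : a ≠ b := by
        rintro rfl
        exact (hO _ _ hab).1 (hO _ _ hab).2
      refine ⟨by simp, by simp [hne], by simp [hab], ?_, ?_⟩
      · simpa using fun y h => (hO _ _ hab).1 (hO _ _ h).2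
      · simpa using fun y h => (hO _ _ h).1 (hO _ _ hab).2
    exact this.length_le_quantumDepth

end Depth

/-! ### Depth two and the position of non-Pauli qubits -/

section Main

variable {V : Type*} [Fintype V] [DecidableEq V] [ord : PartialOrder V] {G : SimpleGraph V}
  [DecidableRel G.Adj] {I O : Finset V} {α : V → Real.Angle} {f : V → V}

theorem IsFlowPattern.exists_list (hf : IsLoopFlow G I O α f ord) {P : Pattern V}
    (hP : IsFlowPattern G O α f ord P) : ∃ L : List V, L.Nodup ∧ (∀ x, x ∈ L ↔ x ∉ O) ∧
      CorrectsLeft G f L ∧ P = listPattern G α f L := by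
  obtain ⟨l, h1, h2, h3, rfl⟩ := hP
  refine ⟨l.reverse, List.nodup_reverse.2 h1, by simpa using h2, ?_, rfl⟩
  rw [CorrectsLeft, List.pairwise_reverse]
  refine (List.Pairwise.and h1 h3).imp_of_mem fun {x y} _ hy h => ?_
  have hy := (h2 y).1 hy
  constructor
  · rintro rfl
    exact h.2 (lt_of_le_of_ne (hf.le_image y hy) h.1.symm)
  · exact fun h' => h.2 (lt_of_le_of_ne (hf.le_nbr y hy x h') h.1.symm)

theorem quantumDepth_eq_two_iff (hf : IsLoopFlow G I O α f ord)
    (hne : ∃ x ∉ O, ∃ y, G.Adj x y) {P : Pattern V} (hP : IsFlowPattern G O α f ord P)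
    {Q : Pattern V} (hQ : IsSimplificationOf P Q) :
    quantumDepth Q = 2 ↔ ∀ j ∉ O, ¬ IsPauliAngle (α j) → ¬ IsImageOfOther O f j := by
  obtain ⟨L, hL, hLO, hLc, rfl⟩ := hP.exists_list hf
  have spec (k : V) : ∃ φ, IsInfluence G O α f k φ ∧ _ := execArc_spec hL hLO hLc hQ k
  have hlt (k j : V) (h : ExecArc Q k j) : k ∉ O ∧ k < j := by
    obtain ⟨φ, hφ, h1, h2⟩ := spec k
    have key (u : Finset V) (hu : ∀ i ∈ u, i ∉ O ∧ i < j) (h : ev φ u = 1) : k ∉ O ∧ k < j := by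
      obtain ⟨i, hi, h'⟩ := exists_ne_zero_of_ev (h.trans_ne one_ne_zero)
      obtain ⟨h3, h4⟩ := hφ.le hf (hu i hi).1 h'
      exact ⟨h3, h4.trans_lt (hu i hi).2⟩
    by_cases hj : j ∈ O
    · rcases (h1 j hj).1 h with h | h
      · exact key _ (fun i hi => hf.lt_of_mem_deps (.inl hi)) h
      · exact key _ (fun i hi => hf.lt_of_mem_deps (.inr hi)) h
    · exact key _ (fun i hi => hf.lt_of_mem_deps (.inl hi)) ((h2 j hj).1 h).2
  have hout {j : V} (hj : j ∉ O) (hfj : f j ≠ j) : ∃ v ∈ O, ExecArc Q j v := by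
    obtain ⟨φ, hφ, h1, -⟩ := spec j
    obtain ⟨v, hv, h⟩ := hφ.exists_output hf hj hfj
    exact ⟨v, hv, (h1 v hv).2 h⟩
  constructor
  · rintro hd j hj hα ⟨i, hi, hij, hfi⟩
    have hfj : f j ≠ j := fun h => hα (.inr (hf.isYAngle_of_eq hj h))
    obtain ⟨v, hv, hjv⟩ := hout hj hfj
    have harc : ExecArc Q i j := by
      obtain ⟨φ, hφ, -, h2⟩ := spec i
      refine (h2 j hj).2 ⟨hα, ?_⟩
      rw [ev, Finset.sum_eq_single_of_mem i (mem_xDeps.2 ⟨hi, hij, hfi⟩), hφ.self hf hi]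
      intro i' hi' hne
      rw [mem_xDeps] at hi'
      exact (hne (hf.injOn hi'.1 hi (hi'.2.2.trans hfi.symm))).elim
    have := three_le_quantumDepth (fun x y h => (hlt x y h).2) harc hjv
      fun x h => (hlt v x h).1 hv
    omega
  · intro hno
    have hO (x y : V) (h : ExecArc Q x y) : x ∉ O ∧ y ∈ O := by
      refine ⟨(hlt x y h).1, ?_⟩
      by_contra hy
      obtain ⟨φ, -, -, h2⟩ := spec x
      obtain ⟨h3, h4⟩ := (h2 y hy).1 h
      obtain ⟨i, hi, -⟩ := exists_ne_zero_of_ev (h4.trans_ne one_ne_zero)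
      exact hno y hy h3 ⟨i, mem_xDeps.1 hi⟩
    obtain ⟨a, b, hab⟩ : ∃ a b, ExecArc Q a b := by
      obtain ⟨x, hx, y, hxy⟩ := hne
      by_cases hfx : f x = x
      -- A looped `x` need not influence an output itself. If `y` is an output, its Z-signal
      -- contains `x`, and a maximal element of that signal yields an arc.
      · by_cases hy : y ∈ O
        · obtain ⟨k, -, hk⟩ := exists_influence_eq_one hf (u := zDeps G O f y)
            ⟨x, mem_zDeps.2 ⟨hx, hxy.ne, by rwa [hfx]⟩⟩ fun i hi => (mem_zDeps.1 hi).1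
          obtain ⟨φ, hφ, h1, -⟩ := spec k
          exact ⟨k, y, (h1 y hy).2 (.inr (hk φ hφ))⟩
        -- Adjacent vertices cannot both carry loops, since each would precede the other; so `y`
        -- influences an output.
        · have hfy : f y ≠ y := fun h => hxy.ne <| le_antisymm
            (hf.le_nbr x hx y (by rwa [hfx])) (hf.le_nbr y hy x (by rw [h]; exact hxy.symm))
          obtain ⟨v, -, h⟩ := hout hy hfy
          exact ⟨y, v, h⟩
      · obtain ⟨v, -, h⟩ := hout hx hfx
        exact ⟨x, v, h⟩
    exact quantumDepth_eq_two hO hab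

-- An injection from `Oᶜ` to the equally large `Iᶜ` is onto, so a non-input is an image, and an
-- image of itself only if it has a loop, hence a Pauli Y angle.
omit [DecidableRel G.Adj] in
theorem IsLoopFlow.mem_inputs_of_card_eq (hf : IsLoopFlow G I O α f ord) (h : I.card = O.card)
    {j : V} (hj : j ∉ O) (hα : ¬ IsPauliAngle (α j)) (hno : ¬ IsImageOfOther O f j) : j ∈ I := by
  by_contra hI
  have hsurj := Finset.surjOn_of_injOn_of_card_le (s := Oᶜ) (t := Iᶜ) f
    (fun x hx => by simpa using hf.maps x (by simpa using hx))
    (fun x hx y hy h => hf.injOn (by simpa using hx) (by simpa using hy) h)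
    (by rw [Finset.card_compl, Finset.card_compl, h])
  obtain ⟨i, hi, hij⟩ := hsurj (show j ∈ (↑Iᶜ : Set V) by simpa using hI)
  have hi : i ∉ O := by simpa using hi
  refine hno ⟨i, hi, ?_, hij⟩
  rintro rfl
  exact hα (.inr (hf.isYAngle_of_eq hi hij))

end Main

end MBQC

theorem mainTheorem7 {V : Type*} [Fintype V] [DecidableEq V]
    (G : SimpleGraph V) [DecidableRel G.Adj] (I O : Finset V)
    (α : V → Real.Angle) (f : V → V) (ord : PartialOrder V)
    (hf : MBQC.IsLoopFlow G I O α f ord)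
    (hne : ∃ x ∉ O, ∃ y, G.Adj x y)
    (P : MBQC.Pattern V) (hP : MBQC.IsFlowPattern G O α f ord P) :
    -- the procedures can be carried out, and for every possible outcome of them:
    (∃ Q, MBQC.IsSimplificationOf P Q) ∧
    (∀ Q, MBQC.IsSimplificationOf P Q →
      (MBQC.quantumDepth Q = 2 ↔
        ∀ j ∉ O, ¬ MBQC.IsPauliAngle (α j) → ¬ MBQC.IsImageOfOther O f j)) ∧
    -- if `f` arises from a flow `f₀` by adding loops, and every flow line begins at an input or
    -- at a loop, then non-Pauli qubits that are not flow images are inputs or adjacent to a loop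
    (∀ (f₀ : V → V) (ord₀ : PartialOrder V), MBQC.IsFlow G I O f₀ ord₀ →
      (∀ x ∉ O, f x = f₀ x ∨ f x = x) →
      (∀ x ∉ O, x ∉ I → ¬ MBQC.IsImageOfOther O f₀ x → f x = x) →
      ∀ j ∉ O, ¬ MBQC.IsPauliAngle (α j) → ¬ MBQC.IsImageOfOther O f j →
        j ∈ I ∨ ∃ y ∉ O, f y = y ∧ G.Adj y j) ∧
    -- if there are as many inputs as outputs, they are inputs
    (I.card = O.card →
      ∀ j ∉ O, ¬ MBQC.IsPauliAngle (α j) → ¬ MBQC.IsImageOfOther O f j → j ∈ I) := by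
  refine ⟨MBQC.exists_isSimplificationOf P, fun Q hQ => MBQC.quantumDepth_eq_two_iff hf hne hP hQ,
    ?_, fun h j hj hα hno => hf.mem_inputs_of_card_eq h hj hα hno⟩
  -- Fixed before the second order `ord₀` enters the context, so that `ord` is the order meant.
  have hY := fun j => hf.isYAngle_of_eq (i := j)
  intro f₀ ord₀ hf₀ hff₀ hloop j hj hα hno
  by_contra! hcon
  obtain ⟨hI, hnb⟩ := hcon
  -- If `j = f₀ i`, either `f` keeps this value and `j` is still an image, or `i` carries a loop and
  -- is adjacent to `j`. If `j` is no image under `f₀`, it carries a loop itself and is Pauli Y.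
  by_cases him : MBQC.IsImageOfOther O f₀ j
  · obtain ⟨i, hi, hij, hfi⟩ := him
    rcases hff₀ i hi with h | h
    · exact hno ⟨i, hi, hij, h.trans hfi⟩
    · exact hnb i hi h (hfi ▸ hf₀.adj i hi)
  · exact hα (.inr (hY j hj (hloop j hj hI him)))
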